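/- Let $N\ge 1$ be an integer, let $\beta\in\{1,4\}$, and let $$\rho_{(1),N}(x;\beta)=\frac{N}{Z_N}\int_{\mathbb R^{N-1}} p(x,x_2,\dots,x_N)\,dx_2\cdots dx_N,\qquad p(x_1,\dots,x_N)=\prod_{l=1}^N e^{-\beta x_l^2/2}\prod_{1\le j<k\le N}|x_k-x_j|^\beta,\qquad Z_N=\int_{\mathbb R^N}p ,$$ be the eigenvalue density of the Gaussian orthogonal ensemble ($\beta=1$) respectively the Gaussian symplectic ensemble ($\beta=4$). Put $N_{\rm s}'=N+\frac{\beta-2}{2\beta}$ and define the soft-edge scaled density $$\rho(y)=\frac{1}{\sqrt2\,(N_{\rm s}')^{1/6}}\;\rho_{(1),N}\!\Big(\sqrt{2N_{\rm s}'}+\frac{y}{\sqrt2\,(N_{\rm s}')^{1/6}};\beta\Big),\qquad y\in\mathbb R.$$ Introduce the differential operators $$\mathcal D_0=\frac4\beta\frac{d^5}{dy^5}-20y\frac{d^3}{dy^3}+12\frac{d^2}{dy^2}+16\beta y^2\frac{d}{dy}-8\beta y,$$ $$\mathcal D_1=-5y^2\frac{d^3}{dy^3}+6y\frac{d^2}{dy^2}+\Big(8\beta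 y^3+14-4\beta-\frac{16}{\beta}\Big)\frac{d}{dy}-6\beta y^2,\qquad \mathcal D_2=\beta y^3\Big(y\frac{d}{dy}-1\Big).$$ Then $\rho$ is five times continuously differentiable on $\mathbb R$ and, for every $y\in\mathbb R$, $$\Big(\mathcal D_0+\frac{1}{(N_{\rm s}')^{2/3}}\mathcal D_1+\frac{1}{(N_{\rm s}')^{4/3}}\mathcal D_2\Big)\rho(y)=0 .$$ -/

import Mathlib

open MeasureTheory

noncomputable section

/-- The unnormalised eigenvalue probability density function
`∏_l w(x_l) ∏_{j<k} |x_k - x_j|^β` on `ℝ^N`. -/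
def eigenvaluePDF (w : ℝ → ℝ) (β : ℝ) (N : ℕ) (x : Fin N → ℝ) : ℝ :=
  (∏ l, w (x l)) * ∏ j, ∏ k ∈ Finset.Ioi j, |x k - x j| ^ β

/-- The normalisation (partition function) `∫_{ℝ^N} ∏_l w(x_l) ∏_{j<k} |x_k - x_j|^β dx`. -/
def partitionFunction (w : ℝ → ℝ) (β : ℝ) (N : ℕ) : ℝ :=
  ∫ x : Fin N → ℝ, eigenvaluePDF w β N x

/-- The eigenvalue density (one-point function, of total mass `N`)
`ρ_{(1),N}(x) = (N / Z_N) ∫_{ℝ^{N-1}} p(x, x_2, …, x_N) dx_2 ⋯ dx_N`. -/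
def eigenvalueDensity (w : ℝ → ℝ) (β : ℝ) : ℕ → ℝ → ℝ
  | 0, _ => 0
  | n + 1, x =>
      ((n + 1 : ℕ) : ℝ) / partitionFunction w β (n + 1) *
        ∫ t : Fin n → ℝ, eigenvaluePDF w β (n + 1) (Fin.cons x t)

/-- The Gaussian weight `e^{-β x² / 2}`. -/
def gaussianWeight (β : ℝ) (x : ℝ) : ℝ := Real.exp (-(β * x ^ 2 / 2))

/-- The eigenvalue density of the Gaussian `β` ensemble
(GOE for `β = 1`, GSE for `β = 4`). -/
def gaussianDensity (β : ℝ) (N : ℕ) : ℝ → ℝ :=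
  eigenvalueDensity (gaussianWeight β) β N

/-- The shifted variable `N'_s = N + (β - 2) / (2 β)`. -/
def shiftedN (β : ℝ) (N : ℕ) : ℝ := N + (β - 2) / (2 * β)

/-- The soft edge scaled density
`(√2 N'^{1/6})⁻¹ ρ_{(1),N}(√(2 N') + y / (√2 N'^{1/6}))`, with `N' = N'_s`. -/
def softEdgeDensity (β : ℝ) (N : ℕ) (y : ℝ) : ℝ :=
  1 / (√2 * shiftedN β N ^ (1 / 6 : ℝ)) *
    gaussianDensity β N
      (√(2 * shiftedN β N) + y / (√2 * shiftedN β N ^ (1 / 6 : ℝ)))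

/-- `(4/β) d⁵/dy⁵ - 20 y d³/dy³ + 12 d²/dy² + 16 β y² d/dy - 8 β y`. -/
def opD0 (β : ℝ) (f : ℝ → ℝ) (y : ℝ) : ℝ :=
  4 / β * iteratedDeriv 5 f y - 20 * y * iteratedDeriv 3 f y + 12 * iteratedDeriv 2 f y
    + 16 * β * y ^ 2 * deriv f y - 8 * β * y * f y

/-- `-5 y² d³/dy³ + 6 y d²/dy² + (8 β y³ + 14 - 4 β - 16/β) d/dy - 6 β y²`. -/
def opD1 (β : ℝ) (f : ℝ → ℝ) (y : ℝ) : ℝ :=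
  -5 * y ^ 2 * iteratedDeriv 3 f y + 6 * y * iteratedDeriv 2 f y
    + (8 * β * y ^ 3 + 14 - 4 * β - 16 / β) * deriv f y - 6 * β * y ^ 2 * f y

/-- `β y³ (y d/dy - 1)`. -/
def opD2 (β : ℝ) (f : ℝ → ℝ) (y : ℝ) : ℝ :=
  β * y ^ 3 * (y * deriv f y - f y)

end

noncomputable section

open Polynomial Filter Topology
open Equiv (Perm)

/-! The equation is linear and homogeneous, so the density is needed only up to a constant factor
and no normalisation is ever evaluated. The heart is a closed form: up to a constant, both densities
equal the quadratic expression `skewForm n x a b E`, where a = ψ_n and b = ψ_{n-1} are Hermite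
functions and E is an antiderivative of ψ_n. Here n = N for the GOE, and n = 2N + 1 with argument √2
x for the GSE (`gaussianDensity_one_eq_skewForm`, `gaussianDensity_four`).

The triple (a, b, E) solves a first-order linear system with polynomial coefficients. The products
b², ab, a², bE, aE span a module stable under differentiation, so six successive derivatives must be
dependent over rational functions; `edge_ode_of_system` checks the stated relation explicitly. In
both ensembles n = q N'_s + 1/2, with q = 1 or 2, so one computation serves both.

For the closed form at β = 1, the joint density is the sign of the Vandermonde product times a
determinant. For distinct points a product of signs ∏ sgn(t_k - y) is a combination of single signs
plus a constant (`prod_sgn_sub_eq`), so integrating out all variables but one leaves Σ g_a (Σ c_ab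
εg_b + c₀_a), with ε the transform of kernel sgn(t - x). At β = 4 the joint density is a confluent
Vandermonde determinant and integration leaves Σ c_ab g_a g_b'. In both cases, pairing the bracket
of index a with g_d, d ≠ a, repeats a function in an alternating expression and gives zero
(`detKernel_eq`, `sum_pfaffCoeff_mul_eq`). In a skew-orthogonal family the pairing matrix is a
perfect matching, so the c_ab are read off. The resulting sum telescopes (`skewSum_add_two`), and
Christoffel–Darboux finishes. For odd GOE size the unpaired function adds a multiple of ψ_{N-1},
which only shifts the constant in E. -/

/-! ### Hermite functions: recurrence, derivative, orthogonality. -/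

/-- Monic Hermite polynomials, orthogonal with respect to `exp (-x ^ 2)`. -/
def monicHermite : ℕ → ℝ[X]
  | 0 => 1
  | 1 => X
  | n + 2 => X * monicHermite (n + 1) - C (((n : ℝ) + 1) / 2) * monicHermite n

theorem monicHermite_monic_natDegree (n : ℕ) :
    (monicHermite n).Monic ∧ (monicHermite n).natDegree = n := by
  induction n using Nat.strong_induction_on with
  | _ n ih =>
    match n with
    | 0 => simp [monicHermite]
    | 1 => simp [monicHermite, monic_X]
    | n + 2 =>
      obtain ⟨m1, d1⟩ := ih (n + 1) (by omega)
      obtain ⟨m0, d0⟩ := ih n (by omega)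
      have hm : (X * monicHermite (n + 1)).Monic := monic_X.mul m1
      have hd : (X * monicHermite (n + 1)).natDegree = n + 2 := by
        rw [monic_X.natDegree_mul m1, d1, natDegree_X]; omega
      have hlt : (C (((n : ℝ) + 1) / 2) * monicHermite n).degree
          < (X * monicHermite (n + 1)).degree := by
        apply degree_lt_degree
        calc _ ≤ (monicHermite n).natDegree := natDegree_C_mul_le _ _
          _ < _ := by rw [d0, hd]; omega
      refine ⟨hm.sub_of_left hlt, ?_⟩
      rw [monicHermite, natDegree_sub_eq_left_of_natDegree_lt, hd]
      calc _ ≤ (monicHermite n).natDegree := natDegree_C_mul_le _ _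
        _ < _ := by rw [d0, hd]; omega

theorem derivative_monicHermite_succ (n : ℕ) :
    derivative (monicHermite (n + 1)) = C ((n : ℝ) + 1) * monicHermite n := by
  induction n using Nat.strong_induction_on with
  | _ n ih =>
    match n with
    | 0 => simp [monicHermite]
    | 1 => simp [monicHermite]; ring
    | n + 2 =>
      have h1 := ih (n + 1) (by omega)
      have h0 := ih n (by omega)
      rw [monicHermite, derivative_sub, derivative_mul, derivative_C_mul, h1, h0, derivative_X,
        show monicHermite (n + 1 + 1)
          = X * monicHermite (n + 1) - C (((n : ℝ) + 1) / 2) * monicHermite n from rfl]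
      have e : (C ((((n + 1 : ℕ) : ℝ) + 1) / 2) : ℝ[X]) * C ((n : ℝ) + 1)
          = C (((n + 1 : ℕ) : ℝ) + 1) * C (((n : ℝ) + 1) / 2) := by
        rw [← C_mul, ← C_mul]; congr 1; ring
      have e' : (C (((n + 2 : ℕ) : ℝ) + 1) : ℝ[X]) = C (((n + 1 : ℕ) : ℝ) + 1) + 1 := by
        rw [← C_1, ← C_add]; congr 1; push_cast; ring
      rw [e']
      linear_combination (-monicHermite n) * e

/-- The Hermite functions `h_n(x) exp (-x ^ 2 / 2)`. -/
def psi (n : ℕ) (x : ℝ) : ℝ := (monicHermite n).eval x * gaussianWeight 1 x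

theorem psi_add_two (n : ℕ) (x : ℝ) :
    psi (n + 2) x = x * psi (n + 1) x - ((n : ℝ) + 1) / 2 * psi n x := by
  simp [psi, monicHermite]; ring

theorem hasDerivAt_gaussianWeight_one (x : ℝ) :
    HasDerivAt (gaussianWeight 1) (-x * gaussianWeight 1 x) x := by
  have : HasDerivAt (fun x : ℝ => -(1 * x ^ 2 / 2)) (-x) x := by
    have := (((hasDerivAt_pow 2 x).const_mul 1).div_const 2).neg
    exact this.congr_deriv (by simp)
  exact this.exp.congr_deriv (mul_comm _ _)

/-- Using the raised function instead of n ψ_{n-1} avoids a special case at n = 0 and keeps the pair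
ψ_n, ψ_{n+1} closed under differentiation. -/
theorem hasDerivAt_psi (n : ℕ) (x : ℝ) :
    HasDerivAt (psi n) (x * psi n x - 2 * psi (n + 1) x) x := by
  have h := ((monicHermite n).hasDerivAt x).mul (hasDerivAt_gaussianWeight_one x)
  refine h.congr_deriv ?_
  match n with
  | 0 => simp [psi, monicHermite]; ring
  | n + 1 =>
    rw [derivative_monicHermite_succ]
    simp [psi, monicHermite]; ring

theorem continuous_psi (n : ℕ) : Continuous (psi n) :=
  continuous_iff_continuousAt.2 fun x => (hasDerivAt_psi n x).continuousAt

theorem integrable_polynomial_mul_exp_neg_mul_sq {b : ℝ} (hb : 0 < b) (p : ℝ[X]) :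
    Integrable fun x : ℝ => p.eval x * Real.exp (-b * x ^ 2) := by
  induction p using Polynomial.induction_on' with
  | add p q hp hq => simp only [eval_add, add_mul]; exact hp.add hq
  | monomial n a =>
    have := (integrable_rpow_mul_exp_neg_mul_sq hb (s := n) (by
      have : (0 : ℝ) ≤ n := n.cast_nonneg
      linarith)).const_mul a
    simpa [mul_assoc] using this

theorem integrable_polynomial_mul_gaussianWeight (p : ℝ[X]) :
    Integrable fun x => p.eval x * gaussianWeight 1 x := by
  convert integrable_polynomial_mul_exp_neg_mul_sq (b := 1 / 2) (by norm_num) p using 3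
  rw [gaussianWeight]; ring_nf

theorem integrable_polynomial_mul_gaussianWeight_mul (p q : ℝ[X]) :
    Integrable fun x => (p.eval x * gaussianWeight 1 x) * (q.eval x * gaussianWeight 1 x) := by
  convert integrable_polynomial_mul_exp_neg_mul_sq (b := 1) (by norm_num) (p * q) using 2 with x
  rw [eval_mul, show -1 * x ^ 2 = -(1 * x ^ 2 / 2) + -(1 * x ^ 2 / 2) by ring, Real.exp_add]
  simp only [gaussianWeight]; ring

theorem integrable_psi (n : ℕ) : Integrable (psi n) :=
  integrable_polynomial_mul_gaussianWeight _

theorem integrable_psi_mul_psi (m n : ℕ) : Integrable fun x => psi m x * psi n x :=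
  integrable_polynomial_mul_gaussianWeight_mul _ _

theorem integrable_id_mul_psi (n : ℕ) : Integrable fun x => x * psi n x := by
  refine (integrable_polynomial_mul_gaussianWeight (X * monicHermite n)).congr (ae_of_all _ ?_)
  intro x; simp [psi, mul_assoc]

theorem integrable_id_mul_psi_mul_psi (m n : ℕ) :
    Integrable fun x => x * psi m x * psi n x := by
  refine (integrable_polynomial_mul_gaussianWeight_mul (X * monicHermite m)
    (monicHermite n)).congr (ae_of_all _ ?_)
  intro x; simp [psi, mul_assoc]

/-- The derivative of the Hermite function `psi n`. -/
def dpsi (n : ℕ) (x : ℝ) : ℝ := x * psi n x - 2 * psi (n + 1) x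

theorem integrable_dpsi (n : ℕ) : Integrable (dpsi n) :=
  (integrable_id_mul_psi n).sub ((integrable_psi (n + 1)).const_mul 2)

theorem integrable_psi_mul_dpsi (m n : ℕ) : Integrable fun x => psi m x * dpsi n x := by
  convert (integrable_id_mul_psi_mul_psi m n).sub ((integrable_psi_mul_psi m (n + 1)).const_mul 2)
    using 2
  simp [dpsi]; ring

theorem integral_psi_mul_dpsi (m n : ℕ) :
    ∫ x, psi m x * dpsi n x = - ∫ x, dpsi m x * psi n x :=
  integral_mul_deriv_eq_deriv_mul_of_integrable (fun x _ => hasDerivAt_psi m x)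
    (fun x _ => hasDerivAt_psi n x) (integrable_psi_mul_dpsi m n)
    ((integrable_psi_mul_dpsi n m).congr (ae_of_all _ fun _ => mul_comm _ _)) (integrable_psi_mul_psi m n)

/-- Integration by parts with ψ' = xψ - 2ψ₊₁. The factor x ψ_n - ψ_{n+1} is the lowered function,
(n/2) ψ_{n-1}, and is zero for n = 0; this drives the induction proving orthogonality. -/
theorem integral_psi_succ_mul_psi (m n : ℕ) :
    ∫ x, psi (m + 1) x * psi n x = ∫ x, psi m x * (x * psi n x - psi (n + 1) x) := by
  have h := integral_psi_mul_dpsi n m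
  have e1 : ∫ x, psi n x * dpsi m x
      = (∫ x, x * psi m x * psi n x) - 2 * ∫ x, psi (m + 1) x * psi n x := by
    rw [← integral_const_mul, ← integral_sub (integrable_id_mul_psi_mul_psi m n)
      ((integrable_psi_mul_psi _ _).const_mul 2)]
    congr with x; simp [dpsi]; ring
  have e2 : ∫ x, dpsi n x * psi m x
      = (∫ x, x * psi m x * psi n x) - 2 * ∫ x, psi m x * psi (n + 1) x := by
    rw [← integral_const_mul, ← integral_sub (integrable_id_mul_psi_mul_psi m n)
      ((integrable_psi_mul_psi _ _).const_mul 2)]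
    congr with x; simp [dpsi]; ring
  have e3 : ∫ x, psi m x * (x * psi n x - psi (n + 1) x)
      = (∫ x, x * psi m x * psi n x) - ∫ x, psi m x * psi (n + 1) x := by
    rw [← integral_sub (integrable_id_mul_psi_mul_psi m n) (integrable_psi_mul_psi _ _)]
    congr with x; ring
  rw [e3]; linarith

theorem integral_psi_succ_mul_psi_succ (m n : ℕ) :
    ∫ x, psi (m + 1) x * psi (n + 1) x = ((n : ℝ) + 1) / 2 * ∫ x, psi m x * psi n x := by
  rw [integral_psi_succ_mul_psi, ← integral_const_mul]
  congr with x; rw [psi_add_two]; ring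

theorem integral_psi_succ_mul_psi_zero (m : ℕ) : ∫ x, psi (m + 1) x * psi 0 x = 0 := by
  rw [integral_psi_succ_mul_psi, ← integral_zero ℝ ℝ]
  congr with x; simp [psi, monicHermite]

theorem integral_psi_mul_psi_of_ne {m n : ℕ} (h : m ≠ n) : ∫ x, psi m x * psi n x = 0 := by
  induction m generalizing n with
  | zero =>
    obtain ⟨n, rfl⟩ := Nat.exists_eq_succ_of_ne_zero h.symm
    simpa [mul_comm] using integral_psi_succ_mul_psi_zero n
  | succ m ih =>
    cases n with
    | zero => exact integral_psi_succ_mul_psi_zero m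
    | succ n => rw [integral_psi_succ_mul_psi_succ, ih (by omega), mul_zero]

/-- The squared norm of `psi n`. -/
def psiNorm (n : ℕ) : ℝ := ∫ x, psi n x * psi n x

theorem psiNorm_succ (n : ℕ) : psiNorm (n + 1) = ((n : ℝ) + 1) / 2 * psiNorm n :=
  integral_psi_succ_mul_psi_succ n n

theorem psiNorm_pos (n : ℕ) : 0 < psiNorm n := by
  induction n with
  | zero =>
    have : psiNorm 0 = √Real.pi := by
      have := integral_gaussian 1
      simp only [div_one] at this
      rw [← this, psiNorm]
      congr with x
      simp only [psi, monicHermite, eval_one, one_mul, gaussianWeight, ← Real.exp_add]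
      congr 1; ring
    rw [this]; positivity
  | succ n ih => rw [psiNorm_succ]; positivity

theorem psiNorm_ne_zero (n : ℕ) : psiNorm n ≠ 0 := (psiNorm_pos n).ne'

theorem integral_psi_mul_psi (m n : ℕ) :
    ∫ x, psi m x * psi n x = if m = n then psiNorm n else 0 := by
  split_ifs with h
  · rw [h, psiNorm]
  · exact integral_psi_mul_psi_of_ne h

theorem dpsi_zero : dpsi 0 = fun x => - psi 1 x := by
  ext x; simp [dpsi, psi, monicHermite]; ring

theorem dpsi_succ (n : ℕ) :
    dpsi (n + 1) = fun x => ((n : ℝ) + 1) / 2 * psi n x - psi (n + 2) x := by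
  ext x; simp [dpsi, psi_add_two]; ring

theorem integral_dpsi (n : ℕ) : ∫ x, dpsi n x = 0 :=
  integral_eq_zero_of_hasDerivAt_of_integrable (fun x => hasDerivAt_psi n x) (integrable_dpsi n)
    (integrable_psi n)

theorem psi_neg (n : ℕ) (x : ℝ) : psi n (-x) = (-1) ^ n * psi n x := by
  induction n using Nat.strong_induction_on with
  | _ n ih =>
    match n with
    | 0 => simp [psi, monicHermite, gaussianWeight]
    | 1 => simp [psi, monicHermite, gaussianWeight]
    | n + 2 =>
      rw [psi_add_two, psi_add_two, ih (n + 1) (by omega), ih n (by omega)]; ring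

theorem integral_psi_add_two (n : ℕ) :
    ∫ x, psi (n + 2) x = ((n : ℝ) + 1) / 2 * ∫ x, psi n x := by
  have h := integral_dpsi (n + 1)
  rw [dpsi_succ, integral_sub ((integrable_psi n).const_mul _) (integrable_psi _),
    integral_const_mul] at h
  linarith

theorem integral_psi_even_ne_zero (k : ℕ) : ∫ x, psi (2 * k) x ≠ 0 := by
  induction k with
  | zero =>
    have := integral_gaussian (1 / 2)
    have h : ∫ x, psi (2 * 0) x = √(Real.pi / (1 / 2)) := by
      rw [← this]
      congr with x
      simp only [psi, monicHermite, eval_one, one_mul, gaussianWeight]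
      congr 1; ring
    rw [h]; positivity
  | succ k ih =>
    rw [show 2 * (k + 1) = 2 * k + 2 by ring, integral_psi_add_two]
    exact mul_ne_zero (by positivity) ih

/-! ### The sign function and the transform with kernel sgn(t - x). -/

/-- The real-valued sign function. -/
def sgn (x : ℝ) : ℝ := (SignType.sign x : ℝ)

theorem sgn_of_pos {x : ℝ} (h : 0 < x) : sgn x = 1 := by simp [sgn, sign_pos h]

theorem sgn_of_neg {x : ℝ} (h : x < 0) : sgn x = -1 := by simp [sgn, sign_neg h]

@[simp] theorem sgn_zero : sgn 0 = 0 := by simp [sgn]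

theorem sgn_neg (x : ℝ) : sgn (-x) = - sgn x := by
  rcases lt_trichotomy x 0 with h | h | h
  · rw [sgn_of_neg h, sgn_of_pos (by linarith)]; norm_num
  · simp [h]
  · rw [sgn_of_pos h, sgn_of_neg (by linarith)]

theorem sgn_mul (x y : ℝ) : sgn (x * y) = sgn x * sgn y := by simp [sgn, sign_mul]

theorem abs_eq_sgn_mul (x : ℝ) : |x| = sgn x * x := (sign_mul_self x).symm

theorem abs_sgn_le_one (x : ℝ) : |sgn x| ≤ 1 := by
  rcases lt_trichotomy x 0 with h | h | h
  · simp [sgn_of_neg h]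
  · simp [h]
  · simp [sgn_of_pos h]

theorem sgn_mul_self_of_ne_zero {x : ℝ} (h : x ≠ 0) : sgn x * sgn x = 1 := by
  rcases h.lt_or_gt with h | h
  · simp [sgn_of_neg h]
  · simp [sgn_of_pos h]

theorem measurable_sgn : Measurable sgn := by
  have : sgn = fun x : ℝ => if x < 0 then -1 else if 0 < x then 1 else 0 := by
    ext x
    rcases lt_trichotomy x 0 with h | h | h
    · simp [sgn_of_neg h, h]
    · simp [h]
    · simp [sgn_of_pos h, h, h.le]
  rw [this]
  exact Measurable.ite measurableSet_Iio measurable_const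
    (Measurable.ite measurableSet_Ioi measurable_const measurable_const)

theorem integrable_sgn_sub_mul {f : ℝ → ℝ} (hf : Integrable f) (x : ℝ) :
    Integrable fun t => sgn (t - x) * f t :=
  hf.bdd_mul (c := 1) (measurable_sgn.comp (measurable_id.sub_const x)).aestronglyMeasurable
    (ae_of_all _ fun _ => abs_sgn_le_one _)

/-- The integral transform with kernel `sgn (t - x)`. -/
def signTransform (f : ℝ → ℝ) (x : ℝ) : ℝ := ∫ t, sgn (t - x) * f t

theorem signTransform_eq {f : ℝ → ℝ} (hf : Integrable f) (x : ℝ) :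
    signTransform f x = (∫ t, f t) - 2 * ∫ t in Set.Iic x, f t := by
  rw [signTransform, ← integral_indicator measurableSet_Iic, ← integral_const_mul,
    ← integral_sub hf ((hf.indicator measurableSet_Iic).const_mul 2)]
  apply integral_congr_ae
  have : ∀ᵐ t : ℝ, t ≠ x := by simp [ae_iff]
  filter_upwards [this] with t ht
  rcases ht.lt_or_gt with h | h
  · rw [sgn_of_neg (by linarith), Set.indicator_of_mem (by exact h.le)]; ring
  · rw [sgn_of_pos (by linarith), Set.indicator_of_notMem (by simpa using h)]; ring

theorem hasDerivAt_signTransform {f : ℝ → ℝ} (hf : Integrable f) (hc : Continuous f) (x : ℝ) :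
    HasDerivAt (signTransform f) (-2 * f x) x := by
  have h : signTransform f
      = fun x => (∫ t, f t) - 2 * ((∫ t in Set.Iic (0 : ℝ), f t) + ∫ t in (0 : ℝ)..x, f t) := by
    ext x
    rw [signTransform_eq hf, ← intervalIntegral.integral_Iic_sub_Iic hf.integrableOn
      hf.integrableOn, add_sub_cancel]
  rw [h]
  have hd := intervalIntegral.integral_hasDerivAt_right (hf.intervalIntegrable (a := 0) (b := x))
    (hc.stronglyMeasurableAtFilter _ _) hc.continuousAt
  refine (((hd.const_add _).const_mul 2).const_sub _).congr_deriv (by ring)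

theorem continuous_signTransform {f : ℝ → ℝ} (hf : Integrable f) (hc : Continuous f) :
    Continuous (signTransform f) :=
  continuous_iff_continuousAt.2 fun x => (hasDerivAt_signTransform hf hc x).continuousAt

theorem abs_signTransform_le {f : ℝ → ℝ} (hf : Integrable f) (x : ℝ) :
    |signTransform f x| ≤ ∫ t, |f t| := by
  refine (norm_integral_le_integral_norm _).trans (integral_mono (integrable_sgn_sub_mul hf x).norm
    hf.abs fun t => ?_)
  simp only [norm_mul, Real.norm_eq_abs]
  exact mul_le_of_le_one_left (abs_nonneg _) (abs_sgn_le_one _)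

theorem integrable_mul_signTransform {f g : ℝ → ℝ} (hg : Integrable g) (hf : Integrable f)
    (hc : Continuous f) : Integrable fun x => g x * signTransform f x :=
  hg.mul_bdd (c := ∫ t, |f t|) (continuous_signTransform hf hc).aestronglyMeasurable
    (ae_of_all _ fun x => abs_signTransform_le hf x)

/-- The transform inverts differentiation up to the factor -2, because an integrable function with
integrable derivative vanishes at both ends. -/
theorem signTransform_of_hasDerivAt {G g : ℝ → ℝ} (h : ∀ x, HasDerivAt G (g x) x)
    (hG : Integrable G) (hg : Integrable g) (x : ℝ) : signTransform g x = -2 * G x := by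
  rw [signTransform_eq hg, integral_eq_zero_of_hasDerivAt_of_integrable h hg hG,
    integral_Iic_of_hasDerivAt_of_tendsto' (m := 0) (fun x _ => h x) hg.integrableOn
      (tendsto_zero_of_hasDerivAt_of_integrableOn_Iic (a := x) (fun x _ => h x) hg.integrableOn
        hG.integrableOn)]
  ring

theorem signTransform_linear {f g : ℝ → ℝ} (hf : Integrable f) (hg : Integrable g) (a b x : ℝ) :
    signTransform (fun t => a * f t + b * g t) x
      = a * signTransform f x + b * signTransform g x := by
  simp only [signTransform]
  rw [← integral_const_mul, ← integral_const_mul, ← integral_add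
    ((integrable_sgn_sub_mul hf x).const_mul a) ((integrable_sgn_sub_mul hg x).const_mul b)]
  congr with t; ring

theorem signTransform_neg_of_parity {f : ℝ → ℝ} {ε : ℝ} (h : ∀ x, f (-x) = ε * f x) (x : ℝ) :
    signTransform f (-x) = -ε * signTransform f x := by
  rw [signTransform, ← integral_neg_eq_self, signTransform, ← integral_const_mul]
  congr with t
  rw [h, show -t - -x = -(t - x) by ring, sgn_neg]; ring

theorem integral_eq_zero_of_odd {f : ℝ → ℝ} (h : ∀ x, f (-x) = - f x) : ∫ x, f x = 0 := by
  have := integral_neg_eq_self f volume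
  simp only [h, integral_neg] at this
  linarith

theorem continuous_dpsi (n : ℕ) : Continuous (dpsi n) := by
  have := continuous_psi n
  have := continuous_psi (n + 1)
  unfold dpsi
  fun_prop

theorem signTransform_dpsi (n : ℕ) (x : ℝ) : signTransform (dpsi n) x = -2 * psi n x :=
  signTransform_of_hasDerivAt (fun x => hasDerivAt_psi n x) (integrable_psi n)
    (integrable_dpsi n) x

theorem signTransform_psi_one (x : ℝ) : signTransform (psi 1) x = 2 * psi 0 x := by
  rw [signTransform_of_hasDerivAt (G := fun x => - psi 0 x) (fun x => ?_) (integrable_psi 0).neg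
    (integrable_psi 1)]
  · ring
  · refine (hasDerivAt_psi 0 x).neg.congr_deriv ?_
    simp [psi, monicHermite]; ring

/-- Transform of the identity ψ_{n+2} = (n+1)/2 ψ_n - ψ_{n+1}'. -/
theorem signTransform_psi_add_two (n : ℕ) (x : ℝ) :
    signTransform (psi (n + 2)) x
      = 2 * psi (n + 1) x + ((n : ℝ) + 1) / 2 * signTransform (psi n) x := by
  have h : psi (n + 2) = fun t => (-1) * dpsi (n + 1) t + ((n : ℝ) + 1) / 2 * psi n t := by
    ext t; rw [dpsi_succ]; ring
  rw [h, signTransform_linear (integrable_dpsi _) (integrable_psi n), signTransform_dpsi]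
  ring

/-! ### Skew pairings of ψ_n and ψ_n'. -/

theorem integral_psi_mul_signTransform_psi_of_even {m n : ℕ} (h : Even (m + n)) :
    ∫ x, psi m x * signTransform (psi n) x = 0 := by
  apply integral_eq_zero_of_odd
  intro x
  rw [psi_neg, signTransform_neg_of_parity (psi_neg n)]
  have : (-1 : ℝ) ^ m * (-1) ^ n = 1 := by rw [← pow_add, h.neg_one_pow]
  linear_combination (-psi m x * signTransform (psi n) x) * this

/-- The transform of ψ_{2j+1} is a combination of ψ_0, ψ_2, …, ψ_{2j}, all orthogonal to ψ_i. -/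
theorem integral_psi_mul_signTransform_psi_odd {j i : ℕ} (h : 2 * j < i) :
    ∫ x, psi i x * signTransform (psi (2 * j + 1)) x = 0 := by
  induction j with
  | zero =>
    simp only [mul_zero, zero_add, signTransform_psi_one, mul_left_comm _ (2 : ℝ),
      integral_const_mul]
    rw [integral_psi_mul_psi_of_ne (by omega), mul_zero]
  | succ j ih =>
    rw [show 2 * (j + 1) + 1 = 2 * j + 1 + 2 by ring]
    simp only [signTransform_psi_add_two, mul_add, mul_left_comm (psi i _)]
    rw [integral_add ((integrable_psi_mul_psi _ _).const_mul 2)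
      ((integrable_mul_signTransform (integrable_psi i) (integrable_psi _)
        (continuous_psi _)).const_mul _), integral_const_mul, integral_const_mul, ih (by omega),
      integral_psi_mul_psi_of_ne (by omega)]
    ring

theorem integral_psi_mul_signTransform_dpsi (m n : ℕ) :
    ∫ x, psi m x * signTransform (dpsi n) x = if m = n then -2 * psiNorm n else 0 := by
  simp only [signTransform_dpsi, mul_left_comm _ (-2 : ℝ), integral_const_mul]
  rw [integral_psi_mul_psi]; simp

theorem integral_dpsi_mul_signTransform_dpsi {m n : ℕ} (h : Even (m + n)) :
    ∫ x, dpsi m x * signTransform (dpsi n) x = 0 := by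
  apply integral_eq_zero_of_odd
  intro x
  have : (-1 : ℝ) ^ m * (-1) ^ n = 1 := by rw [← pow_add, h.neg_one_pow]
  simp only [signTransform_dpsi, dpsi, psi_neg, pow_succ]
  linear_combination (2 * psi n x * (x * psi m x - 2 * psi (m + 1) x)) * this

/-- Integration by parts moves the derivative onto the transform. Together with the three preceding
pairings it makes (ψ_k, ψ_k'), k of one fixed parity, a skew-orthogonal family. -/
theorem integral_dpsi_mul_signTransform_psi (m n : ℕ) :
    ∫ x, dpsi m x * signTransform (psi n) x = if m = n then 2 * psiNorm n else 0 := by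
  have hi := integrable_mul_signTransform (integrable_psi m) (integrable_psi n) (continuous_psi n)
  have hi' := integrable_mul_signTransform (integrable_dpsi m) (integrable_psi n) (continuous_psi n)
  have := integral_mul_deriv_eq_deriv_mul_of_integrable (u := signTransform (psi n)) (v := psi m)
    (fun x _ => hasDerivAt_signTransform (integrable_psi n) (continuous_psi n) x)
    (fun x _ => hasDerivAt_psi m x) (hi'.congr (ae_of_all _ fun x => mul_comm _ _))
    (((integrable_psi_mul_psi n m).const_mul (-2)).congr
      (ae_of_all _ fun x => (mul_assoc _ _ _).symm))
    (hi.congr (ae_of_all _ fun x => mul_comm _ _))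
  simp only [mul_comm (dpsi m _)]
  rw [show (∫ x, signTransform (psi n) x * dpsi m x) = _ from this]
  simp only [mul_assoc, integral_const_mul]
  rw [integral_psi_mul_psi]
  by_cases h : m = n <;> simp [h, eq_comm]

/-! ### Telescoping sums and the Christoffel–Darboux formula. -/

/-- The skew-orthogonal summand of the density. -/
def skewTerm (n : ℕ) (x : ℝ) : ℝ :=
  (psi n x * psi n x + dpsi n x * signTransform (psi n) x / 2) / psiNorm n

/-- The closed form of the sums of `skewTerm`. -/
def skewSum (n : ℕ) (x : ℝ) : ℝ :=
  (∑ j ∈ Finset.range n, psi j x * psi j x / psiNorm j)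
    - n * psi (n - 1) x * signTransform (psi n) x / (4 * psiNorm n)

/-- The telescoping step: the recurrence for the transform of ψ_{n+2} turns the boundary term at n +
2 into the one at n plus the missing summand. -/
theorem skewSum_add_two (n : ℕ) (x : ℝ) :
    skewSum (n + 2) x = skewSum n x + skewTerm n x := by
  have h0 := psiNorm_ne_zero n
  have h1 := psiNorm_succ n
  have h2 := psiNorm_succ (n + 1)
  have hn : (n : ℝ) + 1 ≠ 0 := by positivity
  have hn2 : (n : ℝ) + 1 + 1 ≠ 0 := by positivity
  simp only [skewSum, skewTerm, Finset.sum_range_succ, signTransform_psi_add_two,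
    show n + 2 - 1 = n + 1 by omega]
  -- At n = 0 the truncated `n - 1` is harmless because its coefficient vanishes.
  have hd : dpsi n x = (n : ℝ) / 2 * psi (n - 1) x - psi (n + 1) x := by
    cases n with
    | zero => simp [dpsi_zero]
    | succ n => rw [dpsi_succ]; simp
  rw [hd, show n + 2 = n + 1 + 1 from rfl, h2, h1]
  push_cast
  field_simp
  ring

theorem sum_skewTerm_even (m : ℕ) (x : ℝ) :
    ∑ k ∈ Finset.range m, skewTerm (2 * k) x = skewSum (2 * m) x := by
  induction m with
  | zero => simp [skewSum]
  | succ m ih => rw [Finset.sum_range_succ, ih, ← skewSum_add_two]; rfl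

theorem sum_skewTerm_odd (m : ℕ) (x : ℝ) :
    ∑ k ∈ Finset.range m, skewTerm (2 * k + 1) x = skewSum (2 * m + 1) x := by
  induction m with
  | zero =>
    have h := psiNorm_succ 0
    have h0 := psiNorm_ne_zero 0
    simp [skewSum, signTransform_psi_one, h]
    field_simp
    ring
  | succ m ih => rw [Finset.sum_range_succ, ih, ← skewSum_add_two]; rfl

/-- Christoffel–Darboux on the diagonal, with the derivatives eliminated so that only ψ_n and
ψ_{n+1} remain. -/
theorem psiNorm_mul_sum_psi_sq (n : ℕ) (x : ℝ) :
    psiNorm n * ∑ j ∈ Finset.range (n + 1), psi j x * psi j x / psiNorm j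
      = (n + 1) * psi n x ^ 2 - 2 * x * psi (n + 1) x * psi n x + 2 * psi (n + 1) x ^ 2 := by
  induction n with
  | zero =>
    have h0 := psiNorm_ne_zero 0
    simp [psi, monicHermite]
    field_simp
    ring
  | succ n ih =>
    have h0 := psiNorm_ne_zero (n + 1)
    rw [Finset.sum_range_succ, mul_add, psiNorm_succ, mul_assoc, ih, ← psiNorm_succ, psi_add_two]
    field_simp
    push_cast
    ring

/-- The closed form of the density, up to a constant factor. -/
def skewForm (n x a b E : ℝ) : ℝ := n * b ^ 2 - 2 * x * a * b + 2 * a ^ 2 + b * E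

/-- The last argument, minus half the sign transform, is an antiderivative of ψ_{n+1}; this is all
that the differential equation uses about it. -/
theorem psiNorm_mul_skewSum (n : ℕ) (x : ℝ) :
    psiNorm n * skewSum (n + 1) x
      = skewForm (n + 1) x (psi (n + 1) x) (psi n x) (-signTransform (psi (n + 1)) x / 2) := by
  have h0 := psiNorm_ne_zero n
  have hn : (n : ℝ) + 1 ≠ 0 := by positivity
  rw [skewSum, mul_sub, psiNorm_mul_sum_psi_sq, psiNorm_succ, skewForm]
  simp only [Nat.add_sub_cancel]
  push_cast
  field_simp
  ring

/-! ### From a first-order system to the fifth-order equation. -/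

section

theorem iteratedDeriv_eq_of_hasDerivAt {F : ℕ → ℝ → ℝ} {n : ℕ}
    (h : ∀ k < n, ∀ y, HasDerivAt (F k) (F (k + 1) y) y) {k : ℕ} (hk : k ≤ n) :
    iteratedDeriv k (F 0) = F k := by
  induction k with
  | zero => simp
  | succ k ih =>
    rw [iteratedDeriv_succ, ih (by omega)]
    ext y
    exact (h k (by omega) y).deriv

theorem contDiff_of_hasDerivAt {F : ℕ → ℝ → ℝ} {n : ℕ}
    (h : ∀ k < n, ∀ y, HasDerivAt (F k) (F (k + 1) y) y) (hc : Continuous (F n)) :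
    ContDiff ℝ n (F 0) := by
  rw [contDiff_nat_iff_iteratedDeriv]
  refine ⟨fun m hm => ?_, fun m hm => ?_⟩
  · rw [iteratedDeriv_eq_of_hasDerivAt h hm]
    rcases hm.lt_or_eq with hm | rfl
    · exact continuous_iff_continuousAt.2 fun y => (h m hm y).continuousAt
    · exact hc
  · rw [iteratedDeriv_eq_of_hasDerivAt h hm.le]
    exact fun y => (h m hm y).differentiableAt

/-- A quadratic expression in three functions, with polynomial coefficients. -/
def quadExpr (A B E : ℝ → ℝ) (d : ℝ) (p₁ p₂ p₃ p₄ p₅ : ℝ[X]) (y : ℝ) : ℝ :=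
  p₁.eval (y + d) * (B y * B y) + p₂.eval (y + d) * (A y * B y) + p₃.eval (y + d) * (A y * A y)
    + p₄.eval (y + d) * (B y * E y) + p₅.eval (y + d) * (A y * E y)

/-- The derivatives of the edge-scaled density, for `h = q / (2 r ^ 2)`. -/
def edgeDeriv (A B E : ℝ → ℝ) (d h n : ℝ) : ℕ → ℝ → ℝ
  | 0 => quadExpr A B E d (C n) (C (-4 * h) * X) (C (8 * h)) 1 0
  | 1 => quadExpr A B E d 0 (C (-2 * h)) 0 (C h * X) (C (-4 * h))
  | 2 => quadExpr A B E d (C (-h * n)) (C (2 * h ^ 2) * X) 0 (C (h - 2 * h * n) + C (h ^ 2) * X ^ 2)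
      0
  | 3 => quadExpr A B E d (C (-h ^ 2 * n) * X)
      (C (4 * h ^ 2 + 4 * h ^ 2 * n) + C (2 * h ^ 3) * X ^ 2)
      (C (-8 * h ^ 3) * X) (C (3 * h ^ 2 - 2 * h ^ 2 * n) * X + C (h ^ 3) * X ^ 3)
      (C (-4 * h ^ 2 + 8 * h ^ 2 * n) + C (-4 * h ^ 3) * X ^ 2)
  | 4 => quadExpr A B E d (C (h ^ 2 * n + 2 * h ^ 2 * n ^ 2) + C (-h ^ 3 * n) * X ^ 2)
      (C (10 * h ^ 3 - 4 * h ^ 3 * n) * X + C (2 * h ^ 4) * X ^ 3) (C (-32 * h ^ 3))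
      (C (3 * h ^ 2 - 4 * h ^ 2 * n + 4 * h ^ 2 * n ^ 2) + C (6 * h ^ 3 - 4 * h ^ 3 * n) * X ^ 2
        + C (h ^ 4) * X ^ 4) (C (-16 * h ^ 3) * X)
  | _ => quadExpr A B E d (C (5 * h ^ 3 * n + 2 * h ^ 3 * n ^ 2) * X + C (-h ^ 4 * n) * X ^ 3)
      (C (16 * h ^ 3 - 52 * h ^ 3 * n - 8 * h ^ 3 * n ^ 2) + C (18 * h ^ 4) * X ^ 2
        + C (2 * h ^ 5) * X ^ 4)
      (C (-8 * h ^ 4 + 16 * h ^ 4 * n) * X + C (-8 * h ^ 5) * X ^ 3)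
      (C (15 * h ^ 3 - 20 * h ^ 3 * n + 4 * h ^ 3 * n ^ 2) * X
        + C (10 * h ^ 4 - 4 * h ^ 4 * n) * X ^ 3 + C (h ^ 5) * X ^ 5)
      (C (-28 * h ^ 3 + 16 * h ^ 3 * n - 16 * h ^ 3 * n ^ 2)
        + C (-8 * h ^ 4 + 16 * h ^ 4 * n) * X ^ 2 + C (-4 * h ^ 5) * X ^ 4)

variable {A B E : ℝ → ℝ} {d h n : ℝ}

/-- Since E' is a multiple of A, differentiating BE and AE produces no new products: the five
products are closed under differentiation, which acts on their polynomial coefficients. -/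
theorem hasDerivAt_quadExpr (hA : ∀ y, HasDerivAt A (n / 2 * B y - h * (y + d) * A y) y)
    (hB : ∀ y, HasDerivAt B (h * ((y + d) * B y - 4 * A y)) y)
    (hE : ∀ y, HasDerivAt E (2 * h * A y) y) (p₁ p₂ p₃ p₄ p₅ : ℝ[X]) (y : ℝ) :
    HasDerivAt (quadExpr A B E d p₁ p₂ p₃ p₄ p₅)
      (quadExpr A B E d (derivative p₁ + C (2 * h) * X * p₁ + C (n / 2) * p₂)
        (derivative p₂ - C (8 * h) * p₁ + C n * p₃ + C (2 * h) * p₄)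
        (derivative p₃ - C (4 * h) * p₂ - C (2 * h) * X * p₃ + C (2 * h) * p₅)
        (derivative p₄ + C h * X * p₄ + C (n / 2) * p₅)
        (derivative p₅ - C (4 * h) * p₄ - C h * X * p₅) y) y := by
  have hp : ∀ p : ℝ[X], HasDerivAt (fun y => p.eval (y + d)) ((derivative p).eval (y + d)) y :=
    fun p => (p.hasDerivAt (y + d)).comp_add_const y d
  refine ((((((hp p₁).mul ((hB y).mul (hB y))).add ((hp p₂).mul ((hA y).mul (hB y)))).add
    ((hp p₃).mul ((hA y).mul (hA y)))).add ((hp p₄).mul ((hB y).mul (hE y)))).add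
    ((hp p₅).mul ((hA y).mul (hE y)))).congr_deriv ?_
  simp [quadExpr]
  ring

/-- The tables in `edgeDeriv` are iterates of the coefficient map of `hasDerivAt_quadExpr`, starting
from the density. -/
theorem hasDerivAt_edgeDeriv (hA : ∀ y, HasDerivAt A (n / 2 * B y - h * (y + d) * A y) y)
    (hB : ∀ y, HasDerivAt B (h * ((y + d) * B y - 4 * A y)) y)
    (hE : ∀ y, HasDerivAt E (2 * h * A y) y) (k : ℕ) (hk : k < 5) (y : ℝ) :
    HasDerivAt (edgeDeriv A B E d h n k) (edgeDeriv A B E d h n (k + 1) y) y := by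
  have H := hasDerivAt_quadExpr hA hB hE
  interval_cases k <;> refine (H _ _ _ _ _ y).congr_deriv ?_ <;>
    simp only [quadExpr, edgeDeriv, derivative_add, derivative_mul, derivative_C, derivative_X,
      derivative_X_pow, derivative_zero, derivative_one, eval_add, eval_sub, eval_mul, eval_C,
      eval_X, eval_pow, eval_zero, eval_one] <;> ring

theorem continuous_edgeDeriv_five (hA : Continuous A) (hB : Continuous B) (hE : Continuous E) :
    Continuous (edgeDeriv A B E d h n 5) := by
  simp only [edgeDeriv]
  unfold quadExpr
  fun_prop

theorem edge_ode_of_system {β q r c : ℝ} (hβ : q = 1 ∧ β = 1 ∨ q = 2 ∧ β = 4) (hr : 0 < r)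
    (hh : h = q / (2 * r ^ 2)) (hd : d = 2 * r ^ 4) (hn : n = q * r ^ 6 + 1 / 2)
    (hA : ∀ y, HasDerivAt A (n / 2 * B y - h * (y + d) * A y) y)
    (hB : ∀ y, HasDerivAt B (h * ((y + d) * B y - 4 * A y)) y)
    (hE : ∀ y, HasDerivAt E (2 * h * A y) y) {f : ℝ → ℝ}
    (hf : ∀ y, f y = c * (n * B y ^ 2 - 4 * h * (y + d) * A y * B y + 8 * h * A y ^ 2
      + B y * E y)) :
    ContDiff ℝ 5 f ∧ ∀ y,
      opD0 β f y + 1 / r ^ 4 * opD1 β f y + 1 / r ^ 8 * opD2 β f y = 0 := by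
  set F : ℕ → ℝ → ℝ := fun k y => c * edgeDeriv A B E d h n k y with hF
  have hf0 : f = F 0 := by
    ext y; simp [hf, F, edgeDeriv, quadExpr]; ring_nf; simp
  have hd' : ∀ k < 5, ∀ y, HasDerivAt (F k) (F (k + 1) y) y := fun k hk y =>
    (hasDerivAt_edgeDeriv hA hB hE k hk y).const_mul c
  have hcont : Continuous (F 5) := (continuous_edgeDeriv_five
    (continuous_iff_continuousAt.2 fun y => (hA y).continuousAt)
    (continuous_iff_continuousAt.2 fun y => (hB y).continuousAt)
    (continuous_iff_continuousAt.2 fun y => (hE y).continuousAt)).const_mul c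
  rw [hf0]
  refine ⟨contDiff_of_hasDerivAt hd' hcont, fun y => ?_⟩
  have i {k : ℕ} (hk : k ≤ 5) := iteratedDeriv_eq_of_hasDerivAt hd' hk
  rw [opD0, opD1, opD2, ← iteratedDeriv_one, i le_rfl, i (k := 3) (by norm_num),
    i (k := 2) (by norm_num), i (k := 1) (by norm_num)]
  -- From here the identity is formal in the values of A, B, E at y: the polynomial coefficient of
  -- each of the five products vanishes.
  simp only [F, edgeDeriv, quadExpr, eval_add, eval_mul, eval_C, eval_X, eval_pow, eval_one,
    eval_zero]
  generalize A y = a, B y = b, E y = e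
  subst hh hd hn
  rcases hβ with ⟨rfl, rfl⟩ | ⟨rfl, rfl⟩ <;> field_simp <;> ring

end

theorem edge_ode_skewForm {β q r c s : ℝ} (m : ℕ) (hβ : q = 1 ∧ β = 1 ∨ q = 2 ∧ β = 4)
    (hr : 0 < r) (hs : 0 < s) (hs2 : s ^ 2 = 2 * q) (hn : (m : ℝ) + 1 = q * r ^ 6 + 1 / 2)
    {E f : ℝ → ℝ} (hE : ∀ x, HasDerivAt E (psi (m + 1) x) x)
    (hf : ∀ y, f y = c * skewForm (m + 1) ((y + 2 * r ^ 4) * (s / (2 * r)))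
      (psi (m + 1) ((y + 2 * r ^ 4) * (s / (2 * r)))) (psi m ((y + 2 * r ^ 4) * (s / (2 * r))))
      (E ((y + 2 * r ^ 4) * (s / (2 * r))))) :
    ContDiff ℝ 5 f ∧ ∀ y,
      opD0 β f y + 1 / r ^ 4 * opD1 β f y + 1 / r ^ 8 * opD2 β f y = 0 := by
  set X : ℝ → ℝ := fun y => (y + 2 * r ^ 4) * (s / (2 * r)) with hX
  have hXd (y : ℝ) : HasDerivAt X (s / (2 * r)) y := by
    simpa using ((hasDerivAt_id y).add_const (2 * r ^ 4)).mul_const (s / (2 * r))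
  -- The factor r / s on ψ_{m+1} makes s enter the system only through s² = 2q. With this choice h
  -- (y + d)² is the square of the Hermite argument.
  refine edge_ode_of_system (A := fun y => r / s * psi (m + 1) (X y)) (B := fun y => psi m (X y))
    (E := fun y => E (X y)) (c := c) hβ hr rfl rfl hn ?_ ?_ ?_ ?_
  · intro y
    refine (((hasDerivAt_psi (m + 1) (X y)).comp y (hXd y)).const_mul (r / s)).congr_deriv ?_
    have : q = s ^ 2 / 2 := by linarith
    rw [psi_add_two, this]
    simp only [hX]
    field_simp
    ring
  · intro y
    refine ((hasDerivAt_psi m (X y)).comp y (hXd y)).congr_deriv ?_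
    have : q = s ^ 2 / 2 := by linarith
    rw [this]
    simp only [hX]
    field_simp
    ring
  · intro y
    refine ((hE (X y)).comp y (hXd y)).congr_deriv ?_
    have : q = s ^ 2 / 2 := by linarith
    rw [this]
    field_simp
  · intro y
    have : q = s ^ 2 / 2 := by linarith
    rw [hf, this, skewForm]
    simp only [hX]
    field_simp
    ring

/-- Here r is the sixth root of N'_s, and s / √2 = √q is the ratio between the Hermite argument and
the spectral variable: 1 for the GOE, √2 for the GSE. -/
theorem edge_ode_softEdgeDensity {β q r c s : ℝ} {N : ℕ} (m : ℕ)
    (hβ : q = 1 ∧ β = 1 ∨ q = 2 ∧ β = 4) (hr : 0 < r) (hs : 0 < s) (hs2 : s ^ 2 = 2 * q)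
    (hn : (m : ℝ) + 1 = q * r ^ 6 + 1 / 2) (hN : shiftedN β N = r ^ 6)
    {E : ℝ → ℝ} (hE : ∀ x, HasDerivAt E (psi (m + 1) x) x)
    (hf : ∀ x, gaussianDensity β N x = c * skewForm (m + 1) (s / √2 * x)
      (psi (m + 1) (s / √2 * x)) (psi m (s / √2 * x)) (E (s / √2 * x))) :
    ContDiff ℝ 5 (softEdgeDensity β N) ∧
      ∀ y : ℝ,
        opD0 β (softEdgeDensity β N) y
          + 1 / shiftedN β N ^ (2 / 3 : ℝ) * opD1 β (softEdgeDensity β N) y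
          + 1 / shiftedN β N ^ (4 / 3 : ℝ) * opD2 β (softEdgeDensity β N) y = 0 := by
  have hp (t : ℝ) : shiftedN β N ^ t = r ^ (6 * t) := by
    rw [hN, ← Real.rpow_natCast, ← Real.rpow_mul hr.le]; norm_num
  have h1 : shiftedN β N ^ (1 / 6 : ℝ) = r := by rw [hp]; norm_num
  have h4 : shiftedN β N ^ (2 / 3 : ℝ) = r ^ 4 := by
    rw [hp, ← Real.rpow_natCast]; norm_num
  have h8 : shiftedN β N ^ (4 / 3 : ℝ) = r ^ 8 := by
    rw [hp, ← Real.rpow_natCast]; norm_num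
  rw [h4, h8]
  refine edge_ode_skewForm (c := 1 / (√2 * r) * c) m hβ hr hs hs2 hn hE fun y => ?_
  have h2 : √2 * √2 = 2 := Real.mul_self_sqrt (by norm_num)
  have hx : s / √2 * (√(2 * shiftedN β N) + y / (√2 * shiftedN β N ^ (1 / 6 : ℝ)))
      = (y + 2 * r ^ 4) * (s / (2 * r)) := by
    have : √(2 * shiftedN β N) = √2 * r ^ 3 := by
      rw [hN, Real.sqrt_mul (by norm_num), show r ^ 6 = (r ^ 3) ^ 2 by ring,
        Real.sqrt_sq (by positivity)]
    rw [this, h1]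
    field_simp
    rw [show √2 ^ 2 = 2 by rw [sq, h2]]
    ring
  rw [softEdgeDensity, hf, hx, h1, mul_assoc]

/-! ### Integrating the sign of the Vandermonde product. -/

/-- The sign of the Vandermonde product. -/
def signProd {n : ℕ} (x : Fin n → ℝ) : ℝ := ∏ j, ∏ k ∈ Finset.Ioi j, sgn (x k - x j)

theorem sgn_prod {ι : Type*} (s : Finset ι) (f : ι → ℝ) :
    sgn (∏ i ∈ s, f i) = ∏ i ∈ s, sgn (f i) := by
  induction s using Finset.cons_induction with
  | empty => simp [sgn]
  | cons a s h ih => rw [Finset.prod_cons, Finset.prod_cons, sgn_mul, ih]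

theorem signProd_eq_sgn_det {n : ℕ} (x : Fin n → ℝ) :
    signProd x = sgn (Matrix.vandermonde x).det := by
  simp [signProd, Matrix.det_vandermonde, sgn_prod]

theorem sgn_sign_perm {n : ℕ} (σ : Perm (Fin n)) :
    sgn ((Perm.sign σ : ℤ) : ℝ) = ((Perm.sign σ : ℤ) : ℝ) := by
  rcases Int.units_eq_one_or (Perm.sign σ) with h | h
  · rw [h]; simp [sgn_of_pos]
  · rw [h]; simp [sgn_of_neg]

theorem signProd_comp_perm {n : ℕ} (σ : Perm (Fin n)) (x : Fin n → ℝ) :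
    signProd (x ∘ σ) = ((Perm.sign σ : ℤ) : ℝ) * signProd x := by
  have : Matrix.vandermonde (x ∘ σ) = (Matrix.vandermonde x).submatrix σ id := by
    ext i j; simp [Matrix.vandermonde]
  rw [signProd_eq_sgn_det, signProd_eq_sgn_det, this, Matrix.det_permute, sgn_mul, sgn_sign_perm]

theorem signProd_cons {n : ℕ} (y : ℝ) (t : Fin n → ℝ) :
    signProd (Fin.cons y t : Fin (n + 1) → ℝ) = (∏ k, sgn (t k - y)) * signProd t := by
  simp [signProd, Fin.prod_univ_succ, Fin.prod_Ioi_succ]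

theorem abs_signProd_le_one {n : ℕ} (x : Fin n → ℝ) : |signProd x| ≤ 1 := by
  rw [signProd_eq_sgn_det]; exact abs_sgn_le_one _

theorem measurable_signProd (n : ℕ) : Measurable (signProd : (Fin n → ℝ) → ℝ) := by
  unfold signProd
  refine Finset.measurable_prod _ fun j _ => Finset.measurable_prod _ fun k _ => ?_
  exact measurable_sgn.comp ((measurable_pi_apply k).sub (measurable_pi_apply j))

/-- As functions of y both sides are step functions with the same jumps at the points of T. This
linearises a product of signs, and the induction adds a new maximum each time. -/
theorem prod_sgn_sub_eq (T : Finset ℝ) (y : ℝ) :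
    ∏ t ∈ T, sgn (t - y) = (if Even T.card then 1 else 0)
      + ∑ t ∈ T, sgn (t - y) * ∏ u ∈ T.erase t, sgn (u - t) := by
  induction T using Finset.induction_on_max with
  | empty => simp
  | insert m T hm ih =>
    have hmT : m ∉ T := fun h => lt_irrefl _ (hm m h)
    have h1 : ∏ u ∈ T, sgn (u - m) = (-1) ^ T.card := by
      rw [Finset.prod_congr rfl fun u hu => sgn_of_neg (sub_neg.2 (hm u hu)), Finset.prod_const]
    have h2 : ∑ t ∈ T, sgn (t - y) * ∏ u ∈ (insert m T).erase t, sgn (u - t)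
        = ∑ t ∈ T, sgn (t - y) * ∏ u ∈ T.erase t, sgn (u - t) := by
      refine Finset.sum_congr rfl fun t ht => ?_
      rw [Finset.erase_insert_of_ne (hm t ht).ne', Finset.prod_insert
        (fun h => hmT (Finset.mem_of_mem_erase h)), sgn_of_pos (sub_pos.2 (hm t ht)), one_mul]
    rw [Finset.prod_insert hmT, Finset.sum_insert hmT, Finset.erase_insert hmT, h1, h2,
      Finset.card_insert_of_notMem hmT]
    -- Either y lies below the new maximum and the first factor vanishes, or y is above all of T and
    -- every sign in the product is -1.
    have h3 : (sgn (m - y) - 1) * (∏ t ∈ T, sgn (t - y) - (-1) ^ T.card) = 0 := by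
      rcases lt_or_ge y m with h | h
      · rw [sgn_of_pos (sub_pos.2 h)]; ring
      · rw [Finset.prod_congr rfl fun t ht => sgn_of_neg (sub_neg.2 ((hm t ht).trans_le h)),
          Finset.prod_const]
        ring
    rcases Nat.even_or_odd T.card with he | ho
    · rw [if_neg (by rw [Nat.even_add_one]; exact not_not.2 he)]
      rw [if_pos he] at ih
      rw [he.neg_one_pow] at h3 ⊢
      linear_combination h3 + ih
    · rw [if_pos (by rw [Nat.even_add_one]; exact Nat.not_even_iff_odd.2 ho)]
      rw [if_neg (Nat.not_even_iff_odd.2 ho)] at ih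
      rw [ho.neg_one_pow] at h3 ⊢
      linear_combination h3 + ih

theorem prod_sgn_sub_eq_of_injective {n : ℕ} {t : Fin n → ℝ} (ht : Function.Injective t) (y : ℝ) :
    ∏ k, sgn (t k - y) = (if Even n then 1 else 0)
      + ∑ j, sgn (t j - y) * ∏ k ∈ Finset.univ.erase j, sgn (t k - t j) := by
  have h := prod_sgn_sub_eq (Finset.univ.image t) y
  rw [Finset.card_image_of_injective _ ht, Finset.prod_image ht.injOn,
    Finset.sum_image ht.injOn, Finset.card_univ, Fintype.card_fin] at h
  rw [h]
  congr 1
  refine Finset.sum_congr rfl fun j _ => ?_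
  rw [← Finset.image_erase ht, Finset.prod_image ht.injOn]

/-- Evaluate the expansion at y beyond all the points: the product is 1, the constant is 1, and the
remaining sum must vanish. -/
theorem sum_prod_sgn_sub_eq_zero {n : ℕ} (hn : Even n) {t : Fin n → ℝ}
    (ht : Function.Injective t) :
    ∑ j, ∏ k ∈ Finset.univ.erase j, sgn (t k - t j) = 0 := by
  obtain ⟨M, hM⟩ := (Set.finite_range t).bddAbove
  have hlt (k : Fin n) : t k - (M + 1) < 0 := by
    have := hM ⟨k, rfl⟩
    linarith
  have h := prod_sgn_sub_eq_of_injective ht (M + 1)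
  simp only [fun k => sgn_of_neg (hlt k), Finset.prod_const, Finset.card_univ, Fintype.card_fin,
    hn.neg_one_pow, if_pos hn, neg_mul, one_mul, Finset.sum_neg_distrib] at h
  linarith

theorem cons_succAbove_eq_comp {n : ℕ} (t : Fin (n + 1) → ℝ) (j : Fin (n + 1)) :
    (Fin.cons (t j) (fun k => t (j.succAbove k)) : Fin (n + 1) → ℝ) = t ∘ j.cycleRange.symm := by
  ext i
  have := Fin.insertNth_apply_cycleRange_symm j (t j) (fun k => t (j.succAbove k)) i
  rw [← this, Function.comp_apply]
  exact congrFun (Fin.insertNth_self_removeNth j t) _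

/-- Moving t_j to the front costs the sign of a cycle; the factors involving t_j then occur squared
and drop out. -/
theorem prod_erase_mul_signProd {n : ℕ} {t : Fin (n + 1) → ℝ} (ht : Function.Injective t)
    (j : Fin (n + 1)) :
    (∏ k ∈ Finset.univ.erase j, sgn (t k - t j)) * signProd t
      = ((Perm.sign j.cycleRange.symm : ℤ) : ℝ) * signProd (fun k => t (j.succAbove k)) := by
  have h1 := signProd_comp_perm j.cycleRange.symm t
  rw [← cons_succAbove_eq_comp, signProd_cons] at h1
  have hs : ((Perm.sign j.cycleRange.symm : ℤ) : ℝ) * ((Perm.sign j.cycleRange.symm : ℤ) : ℝ)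
      = 1 := by
    rw [← Int.cast_mul, ← Units.val_mul, Int.units_mul_self]; simp
  have h2 : ∏ k ∈ Finset.univ.erase j, sgn (t k - t j)
      = ∏ k, sgn (t (j.succAbove k) - t j) := by
    rw [← Finset.prod_image (s := Finset.univ) (g := j.succAbove)
      (f := fun k => sgn (t k - t j)) Fin.succAbove_right_injective.injOn]
    refine Finset.prod_congr ?_ fun _ _ => rfl
    ext k
    simp
  have h3 : (∏ k, sgn (t (j.succAbove k) - t j)) * (∏ k, sgn (t (j.succAbove k) - t j)) = 1 := by
    rw [← Finset.prod_mul_distrib]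
    exact Finset.prod_eq_one fun k _ => sgn_mul_self_of_ne_zero
      (sub_ne_zero.2 (ht.ne (Fin.succAbove_ne j k)))
  rw [h2]
  linear_combination (-(∏ k, sgn (t (j.succAbove k) - t j)) * signProd t) * hs
    - ((Perm.sign j.cycleRange.symm : ℤ) : ℝ) * (∏ k, sgn (t (j.succAbove k) - t j)) * h1
    + ((Perm.sign j.cycleRange.symm : ℤ) : ℝ) * signProd (fun k => t (j.succAbove k)) * h3

theorem ae_injective (n : ℕ) : ∀ᵐ t : Fin n → ℝ, Function.Injective t := by
  have h (i j : Fin n) (hij : i ≠ j) : ∀ᵐ t : Fin n → ℝ, t i ≠ t j := by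
    let L : (Fin n → ℝ) →ₗ[ℝ] ℝ := LinearMap.proj (R := ℝ) (φ := fun _ => ℝ) i - LinearMap.proj (φ := fun _ => ℝ) j
    have hL : LinearMap.ker L ≠ ⊤ := by
      intro h
      have : L (Pi.single i 1) = 0 := by rw [← LinearMap.mem_ker, h]; trivial
      simp [L, hij.symm] at this
    have := Measure.addHaar_submodule volume (LinearMap.ker L) hL
    rw [ae_iff]
    convert this using 2
    ext t
    simp [L, sub_eq_zero]
  have h' : ∀ᵐ t : Fin n → ℝ, ∀ i j, i ≠ j → t i ≠ t j := by
    rw [ae_all_iff]; intro i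
    rw [ae_all_iff]; intro j
    by_cases hij : i = j
    · simp [hij]
    · filter_upwards [h i j hij] with t ht _ using ht
  filter_upwards [h'] with t ht i j hij
  by_contra hne
  exact ht i j hne hij

/-- The integral of `signProd` against a product function. -/
def signIntegral {n : ℕ} (h : Fin n → ℝ → ℝ) : ℝ := ∫ t : Fin n → ℝ, signProd t * ∏ j, h j (t j)

theorem integrable_bdd_mul_prod {n : ℕ} {h : Fin n → ℝ → ℝ} (hh : ∀ j, Integrable (h j))
    {φ : (Fin n → ℝ) → ℝ} (hφ : Measurable φ) (hb : ∀ t, |φ t| ≤ 1) :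
    Integrable fun t : Fin n → ℝ => φ t * ∏ j, h j (t j) :=
  (Integrable.fintype_prod hh).bdd_mul (c := 1) hφ.aestronglyMeasurable (ae_of_all _ hb)

theorem signIntegral_comp_perm {n : ℕ} (h : Fin n → ℝ → ℝ) (σ : Perm (Fin n)) :
    signIntegral (fun j => h (σ j)) = ((Perm.sign σ : ℤ) : ℝ) * signIntegral h := by
  have hm := volume_measurePreserving_piCongrLeft (fun _ : Fin n => ℝ) σ
  have h1 := hm.integral_comp' (fun z : Fin n → ℝ => signProd z * ∏ j, h j (z j))
  rw [signIntegral, signIntegral, ← h1, ← integral_const_mul]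
  congr with x
  set z := MeasurableEquiv.piCongrLeft (fun _ : Fin n => ℝ) σ x with hz
  have hzx : ∀ i, x i = z (σ i) := fun i =>
    (Equiv.piCongrLeft_apply_apply (fun _ : Fin n => ℝ) σ x i).symm
  have hx : x = z ∘ σ := funext hzx
  rw [← Equiv.prod_comp σ (fun j => h j (z j)), ← mul_assoc, ← signProd_comp_perm, ← hx]
  simp only [hzx]

theorem signIntegral_eq_zero {n : ℕ} (h : Fin n → ℝ → ℝ) {i j : Fin n} (hij : i ≠ j)
    (he : h i = h j) : signIntegral h = 0 := by
  have h1 := signIntegral_comp_perm h (Equiv.swap i j)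
  have h2 : (fun k => h (Equiv.swap i j k)) = h := by
    ext k x
    rcases eq_or_ne k i with rfl | hi
    · rw [Equiv.swap_apply_left, he]
    · rcases eq_or_ne k j with rfl | hj
      · rw [Equiv.swap_apply_right, he]
      · rw [Equiv.swap_apply_of_ne_of_ne hi hj]
  rw [h2, Perm.sign_swap hij] at h1
  simp at h1
  linarith

theorem integral_mul_removeNth {n : ℕ} (f : ℝ → ℝ) (F : (Fin n → ℝ) → ℝ) (j : Fin (n + 1)) :
    ∫ t : Fin (n + 1) → ℝ, f (t j) * F (fun k => t (j.succAbove k)) = (∫ x, f x) * ∫ t, F t := by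
  rw [← integral_prod_mul]
  exact (volume_preserving_piFinSuccAbove (fun _ : Fin (n + 1) => ℝ) j).integral_comp'
    (fun p : ℝ × (Fin n → ℝ) => f p.1 * F p.2)

theorem integral_mul_signProd_removeNth {n : ℕ} (φ : ℝ → ℝ) (h : Fin (n + 1) → ℝ → ℝ)
    (j : Fin (n + 1)) :
    ∫ t : Fin (n + 1) → ℝ, φ (t j) * signProd (fun k => t (j.succAbove k)) * ∏ i, h i (t i)
      = (∫ x, φ x * h j x) * signIntegral fun k => h (j.succAbove k) := by
  rw [signIntegral, ← integral_mul_removeNth]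
  congr with t
  rw [Fin.prod_univ_succAbove _ j]; ring

theorem abs_mul_signProd_removeNth_le_one {n : ℕ} {φ : ℝ → ℝ} (hb : ∀ x, |φ x| ≤ 1)
    (j : Fin (n + 1)) (t : Fin (n + 1) → ℝ) :
    |φ (t j) * signProd (fun k => t (j.succAbove k))| ≤ 1 := by
  rw [abs_mul]
  exact mul_le_one₀ (hb _) (abs_nonneg _) (abs_signProd_le_one _)

theorem integrable_mul_signProd_removeNth {n : ℕ} {φ : ℝ → ℝ} (hφ : Measurable φ)
    (hb : ∀ x, |φ x| ≤ 1) {h : Fin (n + 1) → ℝ → ℝ} (hh : ∀ j, Integrable (h j))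
    (j : Fin (n + 1)) :
    Integrable fun t : Fin (n + 1) → ℝ =>
      φ (t j) * signProd (fun k => t (j.succAbove k)) * ∏ i, h i (t i) :=
  integrable_bdd_mul_prod hh ((hφ.comp (measurable_pi_apply j)).mul
    ((measurable_signProd n).comp (measurable_pi_lambda _ fun _ => measurable_pi_apply _)))
    (abs_mul_signProd_removeNth_le_one hb j)

/-- The partial integral of `signProd` with one point fixed. -/
def signKernel {n : ℕ} (h : Fin n → ℝ → ℝ) (y : ℝ) : ℝ :=
  ∫ t : Fin n → ℝ, signProd (Fin.cons y t : Fin (n + 1) → ℝ) * ∏ j, h j (t j)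

/-- After the expansion into single signs, the variable t_j separates from the others in each term,
leaving one sign transform times a constant. The two parity clauses determine the constant terms:
the odd one settles even matrix size, the even one odd size. -/
theorem signKernel_eq {n : ℕ} {h : Fin n → ℝ → ℝ} (hh : ∀ j, Integrable (h j)) :
    ∃ (c : Fin n → ℝ) (c₀ : ℝ), (∀ y, signKernel h y = ∑ j, c j * signTransform (h j) y + c₀)
      ∧ (Odd n → c₀ = 0) ∧ (Even n → ∑ j, c j * ∫ x, h j x = 0) := by
  cases n with
  | zero =>
    refine ⟨0, 1, fun y => ?_, fun h => by simp at h, fun _ => by simp⟩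
    simp [signKernel, signProd, volume_pi, measureReal_def]
  | succ n =>
    set s : Fin (n + 1) → ℝ := fun j => ((Perm.sign j.cycleRange.symm : ℤ) : ℝ) with hs
    refine ⟨fun j => s j * signIntegral fun k => h (j.succAbove k),
      (if Even (n + 1) then 1 else 0) * signIntegral h, fun y => ?_, fun ho => ?_, fun he => ?_⟩
    · have hφ : Measurable fun x => sgn (x - y) := measurable_sgn.comp (measurable_id.sub_const y)
      have hi (j : Fin (n + 1)) := (integrable_mul_signProd_removeNth hφ
        (fun x => abs_sgn_le_one _) hh j).const_mul (s j)
      have h0 := (integrable_bdd_mul_prod hh (measurable_signProd (n + 1))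
        abs_signProd_le_one).const_mul (if Even (n + 1) then (1 : ℝ) else 0)
      calc signKernel h y = ∫ t : Fin (n + 1) → ℝ, (∑ j, s j * (sgn (t j - y)
              * signProd (fun k => t (j.succAbove k)) * ∏ i, h i (t i)))
              + (if Even (n + 1) then (1 : ℝ) else 0) * (signProd t * ∏ i, h i (t i)) := by
            refine integral_congr_ae ?_
            filter_upwards [ae_injective (n + 1)] with t ht
            rw [signProd_cons, prod_sgn_sub_eq_of_injective ht, add_mul, add_mul,
              Finset.sum_mul, Finset.sum_mul, add_comm]
            congr 1
            · refine Finset.sum_congr rfl fun j _ => ?_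
              rw [mul_assoc (sgn _), prod_erase_mul_signProd ht]
              ring
            · ring
        _ = _ := by
            rw [integral_add (integrable_finsetSum _ fun j _ => hi j) h0,
              integral_finsetSum _ fun j _ => hi j]
            simp only [integral_const_mul]
            congr 1
            refine Finset.sum_congr rfl fun j _ => ?_
            rw [integral_mul_signProd_removeNth (fun x => sgn (x - y)), signTransform]
            ring
    · rw [if_neg (Nat.not_even_iff_odd.2 ho), zero_mul]
    · have hi (j : Fin (n + 1)) := (integrable_mul_signProd_removeNth (φ := fun _ => 1)
        measurable_const (by simp) hh j).const_mul (s j)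
      calc _ = ∫ t : Fin (n + 1) → ℝ, (∑ j, s j * ((1 : ℝ)
              * signProd (fun k => t (j.succAbove k)) * ∏ i, h i (t i))) := by
            rw [integral_finsetSum _ fun j _ => hi j]
            refine Finset.sum_congr rfl fun j _ => ?_
            rw [integral_const_mul, integral_mul_signProd_removeNth (fun _ => 1)]
            simp only [one_mul]
            ring
        _ = 0 := by
            rw [← integral_zero (Fin (n + 1) → ℝ) ℝ]
            refine integral_congr_ae ?_
            filter_upwards [ae_injective (n + 1)] with t ht
            simp only [one_mul, ← mul_assoc, ← Finset.sum_mul, hs,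
              ← prod_erase_mul_signProd ht, sum_prod_sgn_sub_eq_zero he ht, zero_mul]

theorem signProd_mul_prod_cons_integrable {n : ℕ} {g : ℝ → ℝ} (hg : Integrable g)
    {h : Fin n → ℝ → ℝ} (hh : ∀ j, Integrable (h j)) :
    Integrable (fun p : ℝ × (Fin n → ℝ) =>
      g p.1 * (signProd (Fin.cons p.1 p.2 : Fin (n + 1) → ℝ) * ∏ j, h j (p.2 j)))
      (volume.prod volume) := by
  have hm := (volume_preserving_piFinSuccAbove (fun _ : Fin (n + 1) => ℝ) 0).symm
  have hi := integrable_bdd_mul_prod (h := Fin.cons g h)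
    (fun j => by refine Fin.cases ?_ (fun k => ?_) j <;> simp [hg, hh])
    (measurable_signProd (n + 1)) abs_signProd_le_one
  refine (((hm.integrable_comp_emb (MeasurableEquiv.measurableEmbedding _)).2 hi)).congr
    (ae_of_all _ fun p => ?_)
  simp [Fin.prod_univ_succ, Fin.consEquiv]
  ring

theorem integral_mul_signKernel {n : ℕ} {g : ℝ → ℝ} (hg : Integrable g)
    {h : Fin n → ℝ → ℝ} (hh : ∀ j, Integrable (h j)) :
    ∫ y, g y * signKernel h y = signIntegral (Fin.cons g h : Fin (n + 1) → ℝ → ℝ) := by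
  have hm := (volume_preserving_piFinSuccAbove (fun _ : Fin (n + 1) => ℝ) 0).symm
  rw [signIntegral, ← hm.integral_comp']
  have := integral_prod _ (signProd_mul_prod_cons_integrable hg hh)
  simp only [integral_const_mul] at this
  rw [show (∫ y, g y * signKernel h y) = _ from this.symm]
  refine integral_congr_ae (ae_of_all _ fun p => ?_)
  simp [Fin.prod_univ_succ, Fin.consEquiv]
  ring

/-! ### Determinants against the sign of the Vandermonde product. -/

section

theorem card_perm_apply_zero_eq {n : ℕ} (a : Fin (n + 1)) :
    (Finset.univ.filter fun σ : Perm (Fin (n + 1)) => σ 0 = a).card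
      = (Finset.univ.filter fun σ : Perm (Fin (n + 1)) => σ 0 = 0).card := by
  refine Finset.card_bij' (fun σ _ => Equiv.swap 0 a * σ) (fun σ _ => Equiv.swap 0 a * σ) ?_ ?_ ?_ ?_
  · intro σ hσ
    simp only [Finset.mem_filter, Finset.mem_univ, true_and] at hσ ⊢
    simp [hσ]
  · intro σ hσ
    simp only [Finset.mem_filter, Finset.mem_univ, true_and] at hσ ⊢
    simp [hσ]
  · intro σ _
    simp [← mul_assoc]
  · intro σ _
    simp [← mul_assoc]

theorem sign_mul_self_cast {ι : Type*} [Fintype ι] [DecidableEq ι] (σ : Perm ι) :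
    ((Perm.sign σ : ℤ) : ℝ) * ((Perm.sign σ : ℤ) : ℝ) = 1 := by
  rw [← Int.cast_mul, ← Units.val_mul, Int.units_mul_self]; simp

/-- The partial integral of a determinantal function against the sign of the Vandermonde product. -/
def detKernel {n : ℕ} (g : Fin (n + 1) → ℝ → ℝ) (x : ℝ) : ℝ :=
  ∫ t : Fin n → ℝ, signProd (Fin.cons x t : Fin (n + 1) → ℝ)
    * (Matrix.of fun a j => g a ((Fin.cons x t : Fin (n + 1) → ℝ) j)).det

variable {n : ℕ} {g : Fin (n + 1) → ℝ → ℝ}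

theorem detKernel_eq_sum (hg : ∀ a, Integrable (g a)) (x : ℝ) :
    detKernel g x = ∑ σ : Perm (Fin (n + 1)),
      ((Perm.sign σ : ℤ) : ℝ) * (g (σ 0) x * signKernel (fun k => g (σ (Fin.succ k))) x) := by
  have hi (σ : Perm (Fin (n + 1))) : Integrable fun t : Fin n → ℝ =>
      (((Perm.sign σ : ℤ) : ℝ) * g (σ 0) x) * (signProd (Fin.cons x t : Fin (n + 1) → ℝ)
        * ∏ k, g (σ (Fin.succ k)) (t k)) := by
    refine (integrable_bdd_mul_prod (fun k => hg _) ?_ fun t => abs_signProd_le_one _).const_mul _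
    refine (measurable_signProd (n + 1)).comp (measurable_pi_lambda _ fun j => ?_)
    refine Fin.cases ?_ (fun k => ?_) j
    · simp
    · simpa using measurable_pi_apply k
  calc detKernel g x = ∫ t : Fin n → ℝ, ∑ σ : Perm (Fin (n + 1)),
        (((Perm.sign σ : ℤ) : ℝ) * g (σ 0) x) * (signProd (Fin.cons x t : Fin (n + 1) → ℝ)
        * ∏ k, g (σ (Fin.succ k)) (t k)) := by
        rw [detKernel]
        congr with t
        rw [Matrix.det_apply', Finset.mul_sum]
        refine Finset.sum_congr rfl fun σ _ => ?_
        rw [Fin.prod_univ_succ]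
        simp only [Matrix.of_apply, Fin.cons_zero, Fin.cons_succ]
        ring
    _ = _ := by
        rw [integral_finsetSum _ fun σ _ => hi σ]
        refine Finset.sum_congr rfl fun σ _ => ?_
        rw [integral_const_mul, signKernel, mul_assoc]

/-- The second clause is a cofactor relation: integrating g_d against the bracket of index a
replaces g_a by g_d in an alternating integral. It determines the coefficients without computing
them. -/
theorem detKernel_eq (hg : ∀ a, Integrable (g a)) (hc : ∀ a, Continuous (g a)) :
    ∃ (c : Fin (n + 1) → Fin (n + 1) → ℝ) (c₀ : Fin (n + 1) → ℝ) (κ : ℝ),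
      (∀ x, detKernel g x = ∑ a, g a x * (∑ b, c a b * signTransform (g b) x + c₀ a)) ∧
      (∀ a d, ∑ b, c a b * (∫ x, g d x * signTransform (g b) x) + c₀ a * ∫ x, g d x
        = if a = d then κ else 0) ∧
      (Odd n → c₀ = 0) ∧ (Even n → ∀ a, ∑ b, c a b * ∫ x, g b x = 0) := by
  have H (σ : Perm (Fin (n + 1))) := signKernel_eq (h := fun k => g (σ (Fin.succ k))) fun k => hg _
  choose C C₀ hC hodd heven using H
  set s : Perm (Fin (n + 1)) → ℝ := fun σ => ((Perm.sign σ : ℤ) : ℝ) with hs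
  set c : Fin (n + 1) → Fin (n + 1) → ℝ := fun a b => ∑ σ : Perm (Fin (n + 1)),
    if σ 0 = a then s σ * ∑ k, (if σ (Fin.succ k) = b then C σ k else 0) else 0 with hcdef
  set c₀ : Fin (n + 1) → ℝ := fun a => ∑ σ : Perm (Fin (n + 1)),
    if σ 0 = a then s σ * C₀ σ else 0 with hc₀
  -- Folds any combination with these coefficients back into a sum over permutations; it is
  -- specialised below to transforms, pairings and plain integrals.
  have key (a : Fin (n + 1)) (X : Fin (n + 1) → ℝ) (Y : ℝ) : ∑ b, c a b * X b + c₀ a * Y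
      = ∑ σ : Perm (Fin (n + 1)), if σ 0 = a then
        s σ * (∑ k, C σ k * X (σ (Fin.succ k)) + C₀ σ * Y) else 0 := by
    simp only [hcdef, hc₀, Finset.sum_mul]
    rw [Finset.sum_comm, ← Finset.sum_add_distrib]
    refine Finset.sum_congr rfl fun σ _ => ?_
    split_ifs with h
    · simp only [mul_assoc, ← Finset.mul_sum, ← mul_add, Finset.sum_mul]
      congr 2
      rw [Finset.sum_comm]
      refine Finset.sum_congr rfl fun k _ => ?_
      simp
    · simp
  have hker (d : Fin (n + 1)) (σ : Perm (Fin (n + 1))) :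
      ∑ k, C σ k * (∫ x, g d x * signTransform (g (σ (Fin.succ k))) x) + C₀ σ * ∫ x, g d x
        = signIntegral (Fin.cons (g d) fun k => g (σ (Fin.succ k)) : Fin (n + 1) → ℝ → ℝ) := by
    have hi (k : Fin n) := (integrable_mul_signTransform (hg d) (hg (σ k.succ))
      (hc (σ k.succ))).const_mul (C σ k)
    rw [← integral_mul_signKernel (hg d) fun k => hg _]
    simp only [← integral_const_mul, hC σ]
    rw [← integral_finsetSum _ fun k _ => hi k, ← integral_add
      (integrable_finsetSum _ fun k _ => hi k) ((hg d).const_mul _)]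
    congr with x
    rw [mul_add, Finset.mul_sum, mul_comm (C₀ σ)]
    congr 1
    exact Finset.sum_congr rfl fun k _ => by ring
  refine ⟨c, c₀, (Finset.univ.filter fun σ : Perm (Fin (n + 1)) => σ 0 = 0).card
    * signIntegral g, fun x => ?_, fun a d => ?_, fun ho => ?_, fun he a => ?_⟩
  · rw [detKernel_eq_sum hg]
    have := fun a => key a (fun b => signTransform (g b) x) 1
    simp only [mul_one] at this
    simp only [this, Finset.mul_sum]
    rw [Finset.sum_comm]
    refine Finset.sum_congr rfl fun σ _ => ?_
    simp only [mul_ite, mul_zero, Finset.sum_ite_eq, Finset.mem_univ, if_true]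
    rw [hC σ]
    ring
  · rw [key a (fun b => ∫ x, g d x * signTransform (g b) x)]
    simp only [hker]
    split_ifs with had
    · subst had
      rw [← card_perm_apply_zero_eq a, ← nsmul_eq_mul, ← Finset.sum_const, Finset.sum_filter]
      refine Finset.sum_congr rfl fun σ _ => ?_
      split_ifs with h
      · have : (Fin.cons (g a) fun k => g (σ (Fin.succ k)) : Fin (n + 1) → ℝ → ℝ)
            = fun j => g (σ j) := by
          ext j : 1
          refine Fin.cases ?_ (fun k => ?_) j
          · simp [h]
          · simp
        rw [this, signIntegral_comp_perm, ← mul_assoc, sign_mul_self_cast, one_mul]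
      · rfl
    · refine Finset.sum_eq_zero fun σ _ => ?_
      split_ifs with h
      -- The label d already occurs at a nonzero position, so g_d appears twice and the alternating
      -- integral vanishes.
      · have hne : σ.symm d ≠ 0 := by
          intro h0
          apply had
          rw [← h, ← h0, Equiv.apply_symm_apply]
        obtain ⟨k, hk⟩ := Fin.exists_succ_eq.2 hne
        rw [signIntegral_eq_zero _ (Fin.succ_ne_zero k).symm, mul_zero]
        show g d = g (σ k.succ)
        rw [hk, Equiv.apply_symm_apply]
      · rfl
  · simp only [hc₀, hodd _ ho, mul_zero, ite_self, Finset.sum_const_zero]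
    rfl
  · have := key a (fun b => ∫ x, g b x) 0
    simp only [mul_zero, add_zero] at this
    rw [this]
    simp only [heven _ he, mul_zero, ite_self, Finset.sum_const_zero]

end

theorem detKernel_eq_of_equiv {ι : Type*} [Fintype ι] [DecidableEq ι] {n : ℕ} {g : ι → ℝ → ℝ}
    (e : Fin (n + 1) ≃ ι) (hg : ∀ a, Integrable (g a)) (hc : ∀ a, Continuous (g a)) :
    ∃ (c : ι → ι → ℝ) (c₀ : ι → ℝ) (κ : ℝ),
      (∀ x, detKernel (fun a => g (e a)) x
        = ∑ a, g a x * (∑ b, c a b * signTransform (g b) x + c₀ a)) ∧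
      (∀ a d, ∑ b, c a b * (∫ x, g d x * signTransform (g b) x) + c₀ a * ∫ x, g d x
        = if a = d then κ else 0) ∧
      (Odd n → c₀ = 0) ∧ (Even n → ∀ a, ∑ b, c a b * ∫ x, g b x = 0) := by
  obtain ⟨c, c₀, κ, h1, h2, h3, h4⟩ := detKernel_eq (g := fun a => g (e a)) (fun a => hg _)
    fun a => hc _
  refine ⟨fun a b => c (e.symm a) (e.symm b), fun a => c₀ (e.symm a), κ, fun x => ?_, fun a d => ?_,
    fun ho => ?_, fun he a => ?_⟩
  · rw [h1, ← e.sum_comp]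
    simp only [Equiv.symm_apply_apply]
    refine Finset.sum_congr rfl fun a _ => ?_
    rw [← e.sum_comp]
    simp only [Equiv.symm_apply_apply]
  · have := h2 (e.symm a) (e.symm d)
    simp only [Equiv.apply_symm_apply, EmbeddingLike.apply_eq_iff_eq] at this
    rw [← this, ← e.sum_comp]
    simp only [Equiv.symm_apply_apply]
  · ext a
    simp [h3 ho]
  · rw [← h4 he (e.symm a), ← e.sum_comp]
    simp only [Equiv.symm_apply_apply]

/-! ### The GOE density. -/

theorem exists_det_eval_mul_weight {N : ℕ} (w : ℝ → ℝ) (p : Fin N → ℝ[X]) (hp : ∀ a, p a ≠ 0)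
    (hdeg : ∀ a, (p a).natDegree = a) :
    ∃ K : ℝ, K ≠ 0 ∧ ∀ X : Fin N → ℝ,
      (Matrix.of fun a j => (p a).eval (X j) * w (X j)).det
        = K * ((∏ l, w (X l)) * (Matrix.vandermonde X).det) := by
  refine ⟨∏ a, (p a).leadingCoeff, Finset.prod_ne_zero_iff.2 fun a _ =>
    leadingCoeff_ne_zero.2 (hp a), fun X => ?_⟩
  have h1 : (Matrix.of fun a j => (p a).eval (X j) * w (X j))
      = Matrix.of fun a j => w (X j) * (Matrix.of fun a j => (p a).eval (X j)) a j := by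
    ext a j; simp [mul_comm]
  have h2 : (Matrix.of fun a j => (p a).eval (X j))
      = (Matrix.of fun j a => (p a).eval (X j)).transpose := by
    ext a j; simp
  have h3 : (Matrix.of fun i j : Fin N => (p j).coeff i).det = ∏ a, (p a).leadingCoeff := by
    rw [Matrix.det_of_isUpperTriangular]
    · simp only [Matrix.of_apply, leadingCoeff, hdeg]
    · intro i j hij
      simp only [Matrix.of_apply]
      apply coeff_eq_zero_of_natDegree_lt
      rw [hdeg]
      exact hij
  rw [h1, Matrix.det_mul_row, h2, Matrix.det_transpose,
    Matrix.eval_matrixOfPolynomials_eq_vandermonde_mul_matrixOfPolynomials X p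
      (fun i => (hdeg i).le), Matrix.det_mul, h3]
  ring

theorem prod_abs_sub_eq {N : ℕ} (X : Fin N → ℝ) :
    ∏ j, ∏ k ∈ Finset.Ioi j, |X k - X j| = signProd X * (Matrix.vandermonde X).det := by
  rw [Matrix.det_vandermonde, signProd, ← Finset.prod_mul_distrib]
  refine Finset.prod_congr rfl fun j _ => ?_
  rw [← Finset.prod_mul_distrib]
  exact Finset.prod_congr rfl fun k _ => abs_eq_sgn_mul _

theorem gaussianDensity_one_eq_detKernel {n : ℕ} {g : Fin (n + 1) → ℝ → ℝ} {K : ℝ} (hK : K ≠ 0)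
    (h : ∀ X : Fin (n + 1) → ℝ, (Matrix.of fun a j => g a (X j)).det
      = K * ((∏ l, gaussianWeight 1 (X l)) * (Matrix.vandermonde X).det)) :
    ∃ c : ℝ, ∀ x, gaussianDensity 1 (n + 1) x = c * detKernel g x := by
  refine ⟨((n + 1 : ℕ) : ℝ) / partitionFunction (gaussianWeight 1) 1 (n + 1) * K⁻¹, fun x => ?_⟩
  rw [gaussianDensity, eigenvalueDensity, mul_assoc, detKernel, ← integral_const_mul K⁻¹]
  congr 1
  refine integral_congr_ae (ae_of_all _ fun t => ?_)
  beta_reduce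
  rw [h, eigenvaluePDF]
  simp only [Real.rpow_one]
  rw [prod_abs_sub_eq]
  field_simp

theorem exists_equiv_fin_two_mul (m : ℕ) :
    ∃ e : Fin m ⊕ Fin m ≃ Fin (2 * m),
      ∀ k, (e (.inl k) : ℕ) = 2 * k ∧ (e (.inr k) : ℕ) = 2 * k + 1 := by
  let f : Fin m ⊕ Fin m → Fin (2 * m) :=
    Sum.elim (fun k => ⟨2 * k, by omega⟩) (fun k => ⟨2 * k + 1, by omega⟩)
  have hf : Function.Injective f := by
    rintro (a | a) (b | b) h <;> simp [f, Fin.ext_iff] at h ⊢ <;> omega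
  refine ⟨Equiv.ofBijective f ((Fintype.bijective_iff_injective_and_card f).2 ⟨hf, ?_⟩),
    fun k => ⟨rfl, rfl⟩⟩
  simp; ring

theorem exists_equiv_fin_two_mul_add_one (m : ℕ) :
    ∃ e : Option (Fin m ⊕ Fin m) ≃ Fin (2 * m + 1), (e none : ℕ) = 0 ∧
      ∀ k, (e (some (.inl k)) : ℕ) = 2 * k + 1 ∧ (e (some (.inr k)) : ℕ) = 2 * k + 2 := by
  let f : Option (Fin m ⊕ Fin m) → Fin (2 * m + 1) := fun a =>
    a.elim 0 (Sum.elim (fun k => ⟨2 * k + 1, by omega⟩) (fun k => ⟨2 * k + 2, by omega⟩))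
  have hf : Function.Injective f := by
    rintro (_ | a | a) (_ | b | b) h <;> simp [f, Fin.ext_iff] at h ⊢ <;> omega
  refine ⟨Equiv.ofBijective f ((Fintype.bijective_iff_injective_and_card f).2 ⟨hf, ?_⟩), rfl,
    fun k => ⟨rfl, rfl⟩⟩
  simp; ring

/-- When each column of the pairing matrix has a single nonzero entry, in row p b, the relation
determines every c a b by one division. -/
theorem sum_mul_sum_eq_of_partner {ι : Type*} [Fintype ι] [DecidableEq ι] {c M : ι → ι → ℝ}
    {κ : ℝ} (p : ι → ι) (h : ∀ a d, ∑ b, c a b * M d b = if a = d then κ else 0)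
    (hM : ∀ b b', b' ≠ b → M (p b) b' = 0) (hne : ∀ b, M (p b) b ≠ 0) (u v : ι → ℝ) :
    ∑ a, u a * ∑ b, c a b * v b = κ * ∑ b, u (p b) * v b / M (p b) b := by
  have hcab (a b : ι) : c a b = (if a = p b then κ else 0) / M (p b) b := by
    rw [eq_div_iff (hne b), ← h, Finset.sum_eq_single b (fun b' _ hb => by rw [hM b b' hb, mul_zero])
      (by simp)]
  simp only [Finset.mul_sum]
  rw [Finset.sum_comm]
  refine Finset.sum_congr rfl fun b _ => ?_
  simp only [hcab, ite_div, zero_div, ite_mul, zero_mul, mul_ite, mul_zero, Finset.sum_ite_eq',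
    Finset.mem_univ, if_true]
  ring

/-- The polynomial part of `dpsi n`. -/
def dpsiPoly (n : ℕ) : ℝ[X] := X * monicHermite n - C 2 * monicHermite (n + 1)

theorem dpsi_eq (n : ℕ) (x : ℝ) : dpsi n x = (dpsiPoly n).eval x * gaussianWeight 1 x := by
  simp [dpsi, psi, dpsiPoly]; ring

theorem dpsiPoly_natDegree (n : ℕ) : (dpsiPoly n).natDegree = n + 1 := by
  obtain ⟨m0, d0⟩ := monicHermite_monic_natDegree n
  obtain ⟨m1, d1⟩ := monicHermite_monic_natDegree (n + 1)
  have hc : (dpsiPoly n).coeff (n + 1) = -1 := by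
    have e0 : (monicHermite n).coeff n = 1 := by
      have := m0.coeff_natDegree; rwa [d0] at this
    have e1 : (monicHermite (n + 1)).coeff (n + 1) = 1 := by
      have := m1.coeff_natDegree; rwa [d1] at this
    rw [dpsiPoly, coeff_sub, coeff_X_mul, coeff_C_mul, e0, e1]; norm_num
  refine natDegree_eq_of_le_of_coeff_ne_zero ?_ (by rw [hc]; norm_num)
  refine (natDegree_sub_le _ _).trans (max_le ?_ ?_)
  · rw [monic_X.natDegree_mul m0, natDegree_X, d0]; omega
  · exact (natDegree_C_mul_le _ _).trans d1.le

theorem psi_eq (n : ℕ) (x : ℝ) : psi n x = (monicHermite n).eval x * gaussianWeight 1 x := rfl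

theorem gaussianDensity_one_even (m : ℕ) :
    ∃ c : ℝ, ∀ x, gaussianDensity 1 (2 * (m + 1)) x = c * skewSum (2 * (m + 1)) x := by
  obtain ⟨e, he⟩ := exists_equiv_fin_two_mul (m + 1)
  let g : Fin (m + 1) ⊕ Fin (m + 1) → ℝ → ℝ :=
    Sum.elim (fun k => psi (2 * k)) (fun k => dpsi (2 * k))
  let p : Fin (m + 1) ⊕ Fin (m + 1) → ℝ[X] :=
    Sum.elim (fun k => monicHermite (2 * k)) (fun k => dpsiPoly (2 * k))
  have hgp (a) (x : ℝ) : g a x = (p a).eval x * gaussianWeight 1 x := by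
    rcases a with k | k
    · exact psi_eq _ _
    · exact dpsi_eq _ _
  have hp (a) : p a ≠ 0 := by
    rcases a with k | k
    · exact (monicHermite_monic_natDegree _).1.ne_zero
    · intro h
      have := dpsiPoly_natDegree (2 * k)
      rw [show dpsiPoly (2 * k) = 0 from h, natDegree_zero] at this
      omega
  have hdeg (a) : (p a).natDegree = e a := by
    rcases a with k | k
    · rw [(he k).1]; exact (monicHermite_monic_natDegree _).2
    · rw [(he k).2]; exact dpsiPoly_natDegree _
  obtain ⟨K, hK, hdet⟩ := exists_det_eval_mul_weight (gaussianWeight 1) (fun a => p (e.symm a))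
    (fun a => hp _) fun a => by rw [hdeg, Equiv.apply_symm_apply]
  simp only [← hgp] at hdet
  obtain ⟨c, hc⟩ := gaussianDensity_one_eq_detKernel (n := 2 * m + 1)
    (g := fun a => g (e.symm a)) hK hdet
  have hgi (a) : Integrable (g a) := by
    rcases a with k | k
    · exact integrable_psi _
    · exact integrable_dpsi _
  have hgc (a) : Continuous (g a) := by
    rcases a with k | k
    · exact continuous_psi _
    · exact continuous_dpsi _
  obtain ⟨C, C₀, κ, h1, h2, h3, -⟩ := detKernel_eq_of_equiv (n := 2 * m + 1) e.symm hgi hgc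
  -- Even matrix size means an odd number of integrated variables, so the constant terms vanish.
  have hC₀ := h3 ⟨m, rfl⟩
  simp only [hC₀, Pi.zero_apply, zero_mul, add_zero] at h1 h2
  refine ⟨c * κ, fun x => ?_⟩
  have hne (k : ℕ) := psiNorm_ne_zero k
  have hM1 (k l : ℕ) := integral_psi_mul_signTransform_psi_of_even (m := 2 * k) (n := 2 * l)
    ⟨k + l, by ring⟩
  have hM2 (k l : ℕ) := integral_dpsi_mul_signTransform_dpsi (m := 2 * k) (n := 2 * l)
    ⟨k + l, by ring⟩
  rw [show gaussianDensity 1 (2 * (m + 1)) x = _ from hc x, h1,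
    sum_mul_sum_eq_of_partner Sum.swap h2 ?_ ?_ (fun a => g a x), Fintype.sum_sum_type,
    ← sum_skewTerm_even, ← Fin.sum_univ_eq_sum_range (fun k => skewTerm (2 * k) x), mul_assoc,
    ← Finset.sum_add_distrib]
  · congr 2
    refine Finset.sum_congr rfl fun k _ => ?_
    simp only [Sum.swap_inl, Sum.swap_inr, g, Sum.elim_inl, Sum.elim_inr,
      integral_dpsi_mul_signTransform_psi, integral_psi_mul_signTransform_dpsi, if_true]
    simp only [signTransform_dpsi, skewTerm]
    have := hne (2 * k)
    field_simp
    ring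
  · rintro (k | k) (l | l) h
    · simp only [Sum.swap_inl, g, Sum.elim_inl, Sum.elim_inr, integral_dpsi_mul_signTransform_psi]
      rw [if_neg]
      simpa [Fin.ext_iff, eq_comm] using h
    · simpa [g] using hM2 k l
    · simpa [g] using hM1 k l
    · simp only [Sum.swap_inr, g, Sum.elim_inl, Sum.elim_inr, integral_psi_mul_signTransform_dpsi]
      rw [if_neg]
      simpa [Fin.ext_iff, eq_comm] using h
  · rintro (k | k)
    · simp [g, integral_dpsi_mul_signTransform_psi, hne]
    · simp [g, integral_psi_mul_signTransform_dpsi, hne]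

/-- Iterates ψ_{n+2} = (n+1)/2 ψ_n - ψ_{n+1}', so modulo derivatives of odd Hermite functions ψ_{2j}
is a nonzero multiple of ψ_0. -/
theorem psi_even_eq (j : ℕ) : ∃ (k : ℝ) (a : ℕ → ℝ), k ≠ 0 ∧ ∀ x,
    psi (2 * j) x = k * psi 0 x + ∑ i ∈ Finset.range j, a i * dpsi (2 * i + 1) x := by
  induction j with
  | zero => exact ⟨1, 0, one_ne_zero, by simp⟩
  | succ j ih =>
    obtain ⟨k, a, hk, h⟩ := ih
    have hj : ((2 * j : ℕ) + 1 : ℝ) / 2 ≠ 0 := by positivity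
    refine ⟨((2 * j : ℕ) + 1 : ℝ) / 2 * k,
      fun i => if i = j then -1 else ((2 * j : ℕ) + 1 : ℝ) / 2 * a i, mul_ne_zero hj hk,
      fun x => ?_⟩
    have h1 : dpsi (2 * j + 1) x = ((2 * j : ℕ) + 1 : ℝ) / 2 * psi (2 * j) x
        - psi (2 * (j + 1)) x := by
      rw [dpsi_succ]; rfl
    have h2 : ∀ i ∈ Finset.range j,
        (if i = j then -1 else ((2 * j : ℕ) + 1 : ℝ) / 2 * a i) * dpsi (2 * i + 1) x
          = ((2 * j : ℕ) + 1 : ℝ) / 2 * (a i * dpsi (2 * i + 1) x) := fun i hi => by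
      rw [if_neg (Finset.mem_range.1 hi).ne, mul_assoc]
    rw [Finset.sum_range_succ, Finset.sum_congr rfl h2, ← Finset.mul_sum]
    dsimp only
    rw [if_pos rfl, h1, h]
    ring

/-- A skew-orthogonal family for odd matrix size. -/
def oddFamily (f : ℝ → ℝ) (m : ℕ) : Option (Fin m ⊕ Fin m) → ℝ → ℝ :=
  fun a => a.elim f (Sum.elim (fun k => psi (2 * k + 1)) (fun k => dpsi (2 * k + 1)))

/-- With ψ_0 as unpaired function the degrees are 0, …, 2m and the determinant is triangular over
Vandermonde; a row operation then replaces ψ_0 by ψ_{2m}. -/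
theorem det_oddFamily {m : ℕ} {e : Option (Fin m ⊕ Fin m) ≃ Fin (2 * m + 1)}
    (he₀ : (e none : ℕ) = 0)
    (he : ∀ k, (e (some (.inl k)) : ℕ) = 2 * k + 1 ∧ (e (some (.inr k)) : ℕ) = 2 * k + 2) :
    ∃ K : ℝ, K ≠ 0 ∧ ∀ X : Fin (2 * m + 1) → ℝ,
      (Matrix.of fun a j => oddFamily (psi (2 * m)) m (e.symm a) (X j)).det
        = K * ((∏ l, gaussianWeight 1 (X l)) * (Matrix.vandermonde X).det) := by
  let p : Option (Fin m ⊕ Fin m) → ℝ[X] := fun a => a.elim (monicHermite 0)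
    (Sum.elim (fun k => monicHermite (2 * k + 1)) (fun k => dpsiPoly (2 * k + 1)))
  have hgp (a) (x : ℝ) : oddFamily (psi 0) m a x = (p a).eval x * gaussianWeight 1 x := by
    rcases a with _ | k | k
    · exact psi_eq _ _
    · exact psi_eq _ _
    · exact dpsi_eq _ _
  have hp (a) : p a ≠ 0 := by
    rcases a with _ | k | k
    · exact (monicHermite_monic_natDegree _).1.ne_zero
    · exact (monicHermite_monic_natDegree _).1.ne_zero
    · intro h
      have := dpsiPoly_natDegree (2 * k + 1)
      rw [show dpsiPoly (2 * k + 1) = 0 from h, natDegree_zero] at this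
      omega
  have hdeg (a) : (p a).natDegree = e a := by
    rcases a with _ | k | k
    · rw [he₀]; exact (monicHermite_monic_natDegree _).2
    · rw [(he k).1]; exact (monicHermite_monic_natDegree _).2
    · rw [(he k).2]; exact dpsiPoly_natDegree _
  obtain ⟨K, hK, hdet⟩ := exists_det_eval_mul_weight (gaussianWeight 1) (fun a => p (e.symm a))
    (fun a => hp _) fun a => by rw [hdeg, Equiv.apply_symm_apply]
  simp only [← hgp] at hdet
  obtain ⟨k, a, hk, hpsi⟩ := psi_even_eq m
  refine ⟨k * K, mul_ne_zero hk hK, fun X => ?_⟩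
  let coef : Option (Fin m ⊕ Fin m) → ℝ := fun b => b.elim k (Sum.elim (fun _ => 0) (fun i => a i))
  rw [mul_assoc, ← hdet]
  have hs := Matrix.det_updateRow_sum
    (Matrix.of fun a j => oddFamily (psi 0) m (e.symm a) (X j)) (e none) (fun b => coef (e.symm b))
  rw [Equiv.symm_apply_apply, smul_eq_mul] at hs
  rw [show k = coef none from rfl, ← hs]
  congr 1
  ext b j
  rcases eq_or_ne b (e none) with rfl | hb
  · rw [Matrix.updateRow_self, Matrix.of_apply, Equiv.symm_apply_apply, Finset.sum_apply,
      ← e.sum_comp, Fintype.sum_option, Fintype.sum_sum_type]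
    simp only [Equiv.symm_apply_apply, Pi.smul_apply, Matrix.of_apply, smul_eq_mul, coef, oddFamily,
      Option.elim_none, Option.elim_some, Sum.elim_inl, Sum.elim_inr, zero_mul,
      Finset.sum_const_zero, zero_add]
    rw [hpsi, Fin.sum_univ_eq_sum_range (fun i => a i * dpsi (2 * i + 1) (X j))]
  · rw [Matrix.updateRow_ne hb]
    have hne : e.symm b ≠ none := fun h => hb (by rw [← h, Equiv.apply_symm_apply])
    obtain ⟨c, hc⟩ := Option.ne_none_iff_exists'.1 hne
    simp [hc, oddFamily]

/-- The unpaired function is taken to be ψ_{2m} because it is orthogonal to the transforms of all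
paired functions, and it is the only member with nonzero integral. It therefore decouples and
contributes the additional term. -/
theorem gaussianDensity_one_odd (m : ℕ) :
    ∃ c : ℝ, ∀ x, gaussianDensity 1 (2 * m + 1) x
      = c * (skewSum (2 * m + 1) x + psi (2 * m) x / ∫ t, psi (2 * m) t) := by
  obtain ⟨e, he₀, he⟩ := exists_equiv_fin_two_mul_add_one m
  obtain ⟨K, hK, hdet⟩ := det_oddFamily he₀ he
  set g := oddFamily (psi (2 * m)) m with hg
  obtain ⟨c, hc⟩ := gaussianDensity_one_eq_detKernel (g := fun a => g (e.symm a)) hK hdet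
  have hgi (a) : Integrable (g a) := by
    rcases a with _ | k | k
    · exact integrable_psi _
    · exact integrable_psi _
    · exact integrable_dpsi _
  have hgc (a) : Continuous (g a) := by
    rcases a with _ | k | k
    · exact continuous_psi _
    · exact continuous_psi _
    · exact continuous_dpsi _
  obtain ⟨C, C₀, κ, h1, h2, -, h4⟩ := detKernel_eq_of_equiv (n := 2 * m) e.symm hgi hgc
  have h4 := h4 (even_two_mul m)
  have hI := integral_psi_even_ne_zero m
  have hIodd (k : ℕ) : ∫ x, psi (2 * k + 1) x = 0 := by
    apply integral_eq_zero_of_odd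
    intro x
    rw [psi_neg, pow_succ, pow_mul]
    simp
  have hgI (a : Fin m ⊕ Fin m) : ∫ x, g (some a) x = 0 := by
    rcases a with k | k
    · exact hIodd k
    · exact integral_dpsi _
  have hne (k : ℕ) := psiNorm_ne_zero k
  have hM1 (k l : ℕ) := integral_psi_mul_signTransform_psi_of_even (m := 2 * k + 1)
    (n := 2 * l + 1) ⟨k + l + 1, by ring⟩
  have hM2 (k l : ℕ) := integral_dpsi_mul_signTransform_dpsi (m := 2 * k + 1) (n := 2 * l + 1)
    ⟨k + l + 1, by ring⟩
  -- In the relation Σ c_ab ∫ g_b = 0 only the unpaired function survives.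
  have hC (a) : C a none = 0 := by
    have := h4 a
    rw [Fintype.sum_option] at this
    simp only [hgI, mul_zero, Finset.sum_const_zero, add_zero] at this
    exact (mul_eq_zero.1 this).resolve_right hI
  -- Pairing with ψ_{2m} kills every transform term, leaving c₀_a ∫ ψ_{2m}.
  have hC₀ (a) : C₀ a = if a = none then κ / ∫ t, psi (2 * m) t else 0 := by
    have h := h2 a none
    rw [Fintype.sum_option, hC, zero_mul, zero_add, Finset.sum_eq_zero, zero_add] at h
    · rw [show (∫ x, g none x) = ∫ t, psi (2 * m) t from rfl] at h
      rw [← eq_div_iff hI] at h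
      rw [h, ite_div, zero_div]
    · rintro (k | k) -
      · rw [show (∫ x, g none x * signTransform (g (some (.inl k))) x) = 0 from
          integral_psi_mul_signTransform_psi_odd (by have := k.2; omega), mul_zero]
      · rw [show (∫ x, g none x * signTransform (g (some (.inr k))) x) = _ from
          integral_psi_mul_signTransform_dpsi _ _, if_neg (by omega), mul_zero]
  have hoff (b b' : Fin m ⊕ Fin m) (h : b' ≠ b) :
      ∫ x, g (some b.swap) x * signTransform (g (some b')) x = 0 := by
    rcases b with k | k <;> rcases b' with l | l
    · simp only [Sum.swap_inl, g, oddFamily, Option.elim_some, Sum.elim_inl, Sum.elim_inr,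
        integral_dpsi_mul_signTransform_psi]
      rw [if_neg]
      simpa [Fin.ext_iff, eq_comm] using h
    · simpa [g, oddFamily] using hM2 k l
    · simpa [g, oddFamily] using hM1 k l
    · simp only [Sum.swap_inr, g, oddFamily, Option.elim_some, Sum.elim_inl, Sum.elim_inr,
        integral_psi_mul_signTransform_dpsi]
      rw [if_neg]
      simpa [Fin.ext_iff, eq_comm] using h
  have hdiag (b : Fin m ⊕ Fin m) :
      ∫ x, g (some b.swap) x * signTransform (g (some b)) x ≠ 0 := by
    rcases b with k | k
    · simp [g, oddFamily, integral_dpsi_mul_signTransform_psi, hne]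
    · simp [g, oddFamily, integral_psi_mul_signTransform_dpsi, hne]
  have hCnone (b) : C none b = 0 := by
    rcases b with _ | b
    · exact hC none
    · have h := h2 none (some b.swap)
      rw [hgI, mul_zero, add_zero, Fintype.sum_option, hC, zero_mul, zero_add,
        Finset.sum_eq_single b (fun b' _ hb => by rw [hoff b b' hb, mul_zero]) (by simp),
        if_neg (by simp)] at h
      exact (mul_eq_zero.1 h).resolve_right (hdiag b)
  refine ⟨c * κ, fun x => ?_⟩
  have h2' (a d : Fin m ⊕ Fin m) : ∑ b, C (some a) (some b)
      * (∫ x, g (some d) x * signTransform (g (some b)) x) = if a = d then κ else 0 := by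
    have := h2 (some a) (some d)
    rw [hgI, mul_zero, add_zero, Fintype.sum_option, hC, zero_mul, zero_add] at this
    simpa using this
  have hS : ∑ b, g (some b.swap) x * signTransform (g (some b)) x
      / (∫ x, g (some b.swap) x * signTransform (g (some b)) x) = skewSum (2 * m + 1) x := by
    rw [Fintype.sum_sum_type, ← sum_skewTerm_odd,
      ← Fin.sum_univ_eq_sum_range (fun k => skewTerm (2 * k + 1) x), ← Finset.sum_add_distrib]
    refine Finset.sum_congr rfl fun k _ => ?_
    simp only [Sum.swap_inl, Sum.swap_inr, g, oddFamily, Option.elim_some, Sum.elim_inl,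
      Sum.elim_inr, integral_dpsi_mul_signTransform_psi, integral_psi_mul_signTransform_dpsi,
      if_true]
    simp only [signTransform_dpsi, skewTerm]
    have := hne (2 * k + 1)
    field_simp
    ring
  rw [hc, h1, Fintype.sum_option]
  simp only [Fintype.sum_option, hC, hC₀, hCnone, zero_mul, zero_add, if_true,
    Finset.sum_const_zero, reduceCtorEq, if_false, add_zero]
  rw [sum_mul_sum_eq_of_partner Sum.swap h2' hoff hdiag (fun a => g (some a) x)
      (fun b => signTransform (g (some b)) x), hS]
  simp only [g, oddFamily, Option.elim_none]
  ring

/-! ### Pfaffian sums over permutations. -/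

section

/-- A signed product over the pairs of positions `(inl j, inr j)`; its sum over all permutations
is proportional to the Pfaffian. -/
def pfaffTerm {n : ℕ} (M : Fin n ⊕ Fin n → Fin n ⊕ Fin n → ℝ) (σ : Perm (Fin n ⊕ Fin n)) : ℝ :=
  ((Perm.sign σ : ℤ) : ℝ) * ∏ j, M (σ (.inl j)) (σ (.inr j))

variable {n : ℕ} {M : Fin (n + 1) ⊕ Fin (n + 1) → Fin (n + 1) ⊕ Fin (n + 1) → ℝ}

theorem pfaffTerm_mul_sumCongr (σ : Perm (Fin (n + 1) ⊕ Fin (n + 1))) (τ : Perm (Fin (n + 1))) :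
    pfaffTerm M (σ * Perm.sumCongr τ τ) = pfaffTerm M σ := by
  have h : Perm.sign (σ * Perm.sumCongr τ τ) = Perm.sign σ := by
    rw [Perm.sign_mul, Perm.sign_sumCongr, Int.units_mul_self, mul_one]
  rw [pfaffTerm, pfaffTerm, h]
  congr 1
  exact Equiv.prod_comp τ fun j => M (σ (.inl j)) (σ (.inr j))

theorem pfaffTerm_mul_swap (hM : ∀ a b, M a b = - M b a)
    (σ : Perm (Fin (n + 1) ⊕ Fin (n + 1))) :
    pfaffTerm M (σ * Equiv.swap (.inl 0) (.inr 0)) = pfaffTerm M σ := by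
  rw [pfaffTerm, pfaffTerm, Perm.sign_mul, Perm.sign_swap (by simp), Fin.prod_univ_succ,
    Fin.prod_univ_succ]
  have h (j : Fin n) : M ((σ * Equiv.swap (.inl 0) (.inr 0) : Perm _) (.inl j.succ))
      ((σ * Equiv.swap (.inl 0) (.inr 0) : Perm _) (.inr j.succ))
      = M (σ (.inl j.succ)) (σ (.inr j.succ)) := by
    rw [Perm.mul_apply, Perm.mul_apply, Equiv.swap_apply_of_ne_of_ne, Equiv.swap_apply_of_ne_of_ne]
      <;> simp [Fin.succ_ne_zero]
  rw [Finset.prod_congr rfl fun j _ => h j]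
  simp only [Perm.mul_apply, Equiv.swap_apply_left, Equiv.swap_apply_right]
  rw [hM (σ (.inr 0))]
  push_cast
  ring

/-- Permuting the pairs and flipping one pair preserve each term; together these symmetries act
transitively on positions. -/
theorem exists_pfaffTerm_mul_eq (hM : ∀ a b, M a b = - M b a) (p : Fin (n + 1) ⊕ Fin (n + 1)) :
    ∃ h : Perm (Fin (n + 1) ⊕ Fin (n + 1)), h (.inl 0) = p ∧
      ∀ σ, pfaffTerm M (σ * h) = pfaffTerm M σ := by
  rcases p with j | j
  · exact ⟨Perm.sumCongr (Equiv.swap 0 j) (Equiv.swap 0 j), by simp,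
      fun σ => pfaffTerm_mul_sumCongr σ _⟩
  · refine ⟨Perm.sumCongr (Equiv.swap 0 j) (Equiv.swap 0 j) * Equiv.swap (.inl 0) (.inr 0),
      by simp, fun σ => ?_⟩
    rw [← mul_assoc, pfaffTerm_mul_swap hM, pfaffTerm_mul_sumCongr]

/-- By transitivity the part of the sum with label a at a given position is the same for all
positions, and these parts exhaust the sum. -/
theorem card_mul_sum_pfaffTerm (hM : ∀ a b, M a b = - M b a) (a : Fin (n + 1) ⊕ Fin (n + 1)) :
    (Fintype.card (Fin (n + 1) ⊕ Fin (n + 1)) : ℝ)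
        * ∑ σ, (if σ (.inl 0) = a then pfaffTerm M σ else 0) = ∑ σ, pfaffTerm M σ := by
  have h (p : Fin (n + 1) ⊕ Fin (n + 1)) :
      ∑ σ : Perm (Fin (n + 1) ⊕ Fin (n + 1)), (if σ (.inl 0) = a then pfaffTerm M σ else 0)
        = ∑ σ : Perm (Fin (n + 1) ⊕ Fin (n + 1)), (if σ p = a then pfaffTerm M σ else 0) := by
    obtain ⟨h, hp, hh⟩ := exists_pfaffTerm_mul_eq hM p
    rw [← Equiv.sum_comp (Equiv.mulRight h)]
    simp only [Equiv.coe_mulRight, Perm.mul_apply, hp, hh]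
  rw [← nsmul_eq_mul, ← Finset.card_univ, ← Finset.sum_const, Finset.sum_congr rfl fun p _ => h p,
    Finset.sum_comm]
  refine Finset.sum_congr rfl fun σ _ => ?_
  rw [Finset.sum_eq_single (σ.symm a)]
  · simp
  · intro p _ hp
    rw [if_neg]
    rintro rfl
    simp at hp
  · simp

theorem sum_pfaffTerm_eq_zero {a d : Fin (n + 1) ⊕ Fin (n + 1)} (had : a ≠ d)
    (h : ∀ x y, M (Equiv.swap a d x) (Equiv.swap a d y) = M x y) : ∑ σ, pfaffTerm M σ = 0 := by
  have : ∑ σ, pfaffTerm M σ = - ∑ σ, pfaffTerm M σ := by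
    conv_lhs => rw [← Equiv.sum_comp (Equiv.mulLeft (Equiv.swap a d))]
    rw [← Finset.sum_neg_distrib]
    refine Finset.sum_congr rfl fun σ _ => ?_
    simp only [Equiv.coe_mulLeft, pfaffTerm, Perm.mul_apply, h, Perm.sign_mul,
      Perm.sign_swap had]
    push_cast
    ring
  linarith

/-- The coefficients of the expansion of a Pfaffian along a pair of entries. -/
def pfaffCoeff (M : Fin (n + 1) ⊕ Fin (n + 1) → Fin (n + 1) ⊕ Fin (n + 1) → ℝ)
    (a b : Fin (n + 1) ⊕ Fin (n + 1)) : ℝ :=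
  ∑ σ : Perm (Fin (n + 1) ⊕ Fin (n + 1)), if σ (.inl 0) = a then if σ (.inr 0) = b then
    ((Perm.sign σ : ℤ) : ℝ) * ∏ j : Fin n, M (σ (.inl j.succ)) (σ (.inr j.succ)) else 0 else 0

theorem sum_pfaffCoeff_mul (a : Fin (n + 1) ⊕ Fin (n + 1)) (v : Fin (n + 1) ⊕ Fin (n + 1) → ℝ) :
    ∑ b, pfaffCoeff M a b * v b = ∑ σ : Perm (Fin (n + 1) ⊕ Fin (n + 1)),
      if σ (.inl 0) = a then ((Perm.sign σ : ℤ) : ℝ) * (v (σ (.inr 0))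
        * ∏ j : Fin n, M (σ (.inl j.succ)) (σ (.inr j.succ))) else 0 := by
  simp only [pfaffCoeff, Finset.sum_mul]
  rw [Finset.sum_comm]
  refine Finset.sum_congr rfl fun σ _ => ?_
  split_ifs with h
  · simp only [ite_mul, zero_mul, Finset.sum_ite_eq, Finset.mem_univ, if_true]
    ring
  · simp

/-- Expansion of a Pfaffian along a row, with the usual vanishing when the row comes from another
index. -/
theorem sum_pfaffCoeff_mul_eq (hM : ∀ a b, M a b = - M b a) (a d : Fin (n + 1) ⊕ Fin (n + 1)) :
    ∑ b, pfaffCoeff M a b * M d b = if a = d then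
      (∑ σ, pfaffTerm M σ) / Fintype.card (Fin (n + 1) ⊕ Fin (n + 1)) else 0 := by
  have hcard : (Fintype.card (Fin (n + 1) ⊕ Fin (n + 1)) : ℝ) ≠ 0 := by
    rw [Nat.cast_ne_zero]; exact Fintype.card_ne_zero
  rw [sum_pfaffCoeff_mul]
  split_ifs with had
  · subst had
    rw [eq_div_iff hcard, mul_comm, ← card_mul_sum_pfaffTerm hM a]
    congr 1
    refine Finset.sum_congr rfl fun σ _ => ?_
    split_ifs with h
    · rw [pfaffTerm, Fin.prod_univ_succ, h]
    · rfl
  -- Relabelling a as d gives an antisymmetric form invariant under swapping a and d, whose Pfaffian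
  -- sum is therefore zero; terms with a in the first position are unchanged except for the wanted
  -- factor.
  · set r : Fin (n + 1) ⊕ Fin (n + 1) → Fin (n + 1) ⊕ Fin (n + 1) :=
      fun x => if x = a then d else x with hr
    have hra : r a = d := if_pos rfl
    have hrx {x} (hx : x ≠ a) : r x = x := if_neg hx
    set M' : Fin (n + 1) ⊕ Fin (n + 1) → Fin (n + 1) ⊕ Fin (n + 1) → ℝ :=
      fun x y => M (r x) (r y) with hM'
    have hrs (x) : r (Equiv.swap a d x) = r x := by
      rcases eq_or_ne x a with rfl | hxa
      · rw [Equiv.swap_apply_left, hra, hrx (Ne.symm had)]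
      · rcases eq_or_ne x d with rfl | hxd
        · rw [Equiv.swap_apply_right, hra, hrx hxa]
        · rw [Equiv.swap_apply_of_ne_of_ne hxa hxd]
    have h0 := card_mul_sum_pfaffTerm (M := M') (fun x y => hM _ _) a
    rw [sum_pfaffTerm_eq_zero had (fun x y => by simp only [hM', hrs])] at h0
    refine Eq.trans ?_ ((mul_eq_zero.1 h0).resolve_left hcard)
    refine Finset.sum_congr rfl fun σ _ => ?_
    split_ifs with h
    · have hne {x} (hx : x ≠ .inl 0) : σ x ≠ a := by
        rw [← h]; exact σ.injective.ne hx
      rw [pfaffTerm, Fin.prod_univ_succ]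
      simp only [hM', h, hra]
      rw [hrx (hne (by simp))]
      congr 2
      refine Finset.prod_congr rfl fun j _ => ?_
      rw [hrx (hne (by simp [Fin.succ_ne_zero])), hrx (hne (by simp))]
    · rfl

end

/-! ### The confluent Vandermonde determinant. -/

theorem prod_prod_Ioi_append {m n : ℕ} (X : Fin m → ℝ) (Y : Fin n → ℝ) :
    ∏ i, ∏ j ∈ Finset.Ioi i, (Fin.append X Y j - Fin.append X Y i)
      = (∏ i, ∏ j ∈ Finset.Ioi i, (X j - X i)) * (∏ i, ∏ j ∈ Finset.Ioi i, (Y j - Y i))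
        * ∏ i, ∏ k, (Y k - X i) := by
  have h {N : ℕ} (i : Fin N) : Finset.Ioi i = Finset.univ.filter (i < ·) := by ext; simp
  have h1 (i : Fin n) (j : Fin m) : ¬ (Fin.natAdd m i < Fin.castAdd n j) := by
    rw [Fin.lt_def, Fin.val_natAdd, Fin.val_castAdd]; omega
  have h2 (i : Fin n) (j : Fin m) : Fin.castAdd n j < Fin.natAdd m i := by
    rw [Fin.lt_def, Fin.val_natAdd, Fin.val_castAdd]; omega
  simp only [h, Finset.prod_filter, Fin.prod_univ_add, Fin.append_left, Fin.append_right, h1, h2,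
    if_true, if_false, Finset.prod_const_one, Finset.prod_mul_distrib]
  simp only [Fin.lt_def, Fin.val_natAdd, Fin.val_castAdd, Nat.add_lt_add_iff_left]
  ring

theorem prod_off_diag_eq {N : ℕ} (X : Fin N → ℝ) :
    ∏ i, ∏ k ∈ {i}ᶜ, (X k - X i) = (∏ i : Fin N, ∏ _j ∈ Finset.Ioi i, (-1 : ℝ))
      * (∏ i, ∏ j ∈ Finset.Ioi i, (X j - X i)) ^ 2 := by
  rw [← Finset.prod_prod_Ioi_mul_eq_prod_prod_off_diag (fun k i => X k - X i),
    ← Finset.prod_pow, ← Finset.prod_mul_distrib]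
  refine Finset.prod_congr rfl fun i _ => ?_
  rw [← Finset.prod_pow, ← Finset.prod_mul_distrib]
  exact Finset.prod_congr rfl fun j _ => by ring

theorem prod_prod_sub_add {N : ℕ} (X : Fin N → ℝ) (ε : ℝ) :
    ∏ i, ∏ k, (X k + ε - X i) = ε ^ N * ∏ i, ∏ k ∈ {i}ᶜ, (X k - X i + ε) := by
  have h (i : Fin N) : ∏ k, (X k + ε - X i) = ε * ∏ k ∈ {i}ᶜ, (X k - X i + ε) := by
    rw [Fintype.prod_eq_mul_prod_compl i]
    congr 1
    · ring
    · exact Finset.prod_congr rfl fun k _ => by ring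
  simp only [h, Finset.prod_mul_distrib, Finset.prod_const, Finset.card_univ, Fintype.card_fin]

theorem det_divided_difference {N : ℕ} (A : Matrix (Fin N ⊕ Fin N) (Fin N ⊕ Fin N) ℝ) (ε : ℝ) :
    (Matrix.of fun a b => Sum.elim (fun j => A a (.inl j))
      (fun j => ε⁻¹ * (A a (.inr j) - A a (.inl j))) b).det = A.det * (ε⁻¹) ^ N := by
  have h : (Matrix.of fun a b => Sum.elim (fun j => A a (.inl j))
      (fun j => ε⁻¹ * (A a (.inr j) - A a (.inl j))) b)
      = A * Matrix.fromBlocks 1 (-(ε⁻¹ • (1 : Matrix (Fin N) (Fin N) ℝ))) 0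
        (ε⁻¹ • (1 : Matrix (Fin N) (Fin N) ℝ)) := by
    ext a b
    rcases b with j | j
    · simp [Matrix.mul_apply, Fintype.sum_sum_type, Matrix.one_apply]
    · simp [Matrix.mul_apply, Fintype.sum_sum_type, Matrix.one_apply]
      ring
  rw [h, Matrix.det_mul, Matrix.det_fromBlocks_zero₂₁, Matrix.det_one, one_mul, Matrix.det_smul,
    Matrix.det_one, mul_one, Fintype.card_fin]

/-- Limit of the 2N-point determinant at X_j and X_j + ε as ε → 0. The N diagonal differences give
ε^N, cancelled by the divided differences; the two blocks give D² and the off-diagonal differences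
±D². -/
theorem exists_det_confluent {N : ℕ} {w : ℝ → ℝ} (hw : Continuous w)
    {p : Fin N ⊕ Fin N → ℝ[X]} (hp : ∀ a, p a ≠ 0) {e : Fin N ⊕ Fin N ≃ Fin (2 * N)}
    (hdeg : ∀ a, (p a).natDegree = e a) {g g' : Fin N ⊕ Fin N → ℝ → ℝ}
    (hg : ∀ a x, g a x = (p a).eval x * w x) (hg' : ∀ a x, HasDerivAt (g a) (g' a x) x) :
    ∃ K : ℝ, K ≠ 0 ∧ ∀ X : Fin N → ℝ,
      (Matrix.of fun a b => Sum.elim (fun j => g a (X j)) (fun j => g' a (X j)) b).det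
        = K * ((∏ l, w (X l)) ^ 2 * (∏ i, ∏ j ∈ Finset.Ioi i, (X j - X i)) ^ 4) := by
  set e₁ : Fin N ⊕ Fin N ≃ Fin (N + N) := e.trans (finCongr (two_mul N)) with he₁
  set e₂ : Fin N ⊕ Fin N ≃ Fin (N + N) := finSumFinEquiv with he₂
  -- The rows are ordered by degree but the columns by blocks; τ records the discrepancy, whose sign
  -- goes into K.
  set τ : Perm (Fin (N + N)) := e₁.symm.trans e₂ with hτ
  obtain ⟨K, hK, hdet⟩ := exists_det_eval_mul_weight w (fun a => p (e₁.symm a))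
    (fun a => hp _) fun a => by
      rw [hdeg]
      obtain ⟨b, rfl⟩ := e₁.surjective a
      rw [Equiv.symm_apply_apply]
      rfl
  simp only [← hg] at hdet
  set s : ℝ := ((Perm.sign τ : ℤ) : ℝ) with hs
  have hs2 : s * s = 1 := sign_mul_self_cast τ
  have hs0 : s ≠ 0 := fun h => by simp [h] at hs2
  set S : ℝ := ∏ i : Fin N, ∏ _j ∈ Finset.Ioi i, (-1 : ℝ) with hS
  have hS0 : S ≠ 0 :=
    Finset.prod_ne_zero_iff.2 fun i _ => Finset.prod_ne_zero_iff.2 fun j _ => by norm_num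
  refine ⟨s * K * S, mul_ne_zero (mul_ne_zero hs0 hK) hS0, fun X => ?_⟩
  set D : ℝ := ∏ i, ∏ j ∈ Finset.Ioi i, (X j - X i) with hD
  have hA (Y : Fin N → ℝ) :
      (Matrix.of fun a b => Sum.elim (fun j => g a (X j)) (fun j => g a (Y j)) b).det
        = s * (K * (((∏ l, w (X l)) * ∏ l, w (Y l)) * (D * (∏ i, ∏ j ∈ Finset.Ioi i, (Y j - Y i))
          * ∏ i, ∏ k, (Y k - X i)))) := by
    have h1 := hdet (Fin.append X Y)
    rw [Matrix.det_vandermonde, prod_prod_Ioi_append, Fin.prod_univ_add] at h1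
    simp only [Fin.append_left, Fin.append_right] at h1
    rw [← h1, ← Matrix.det_submatrix_equiv_self e₂.symm]
    have h2 : (Matrix.of fun a j => g (e₁.symm a) (Fin.append X Y j))
        = (((Matrix.of fun a b => Sum.elim (fun j => g a (X j)) (fun j => g a (Y j)) b).submatrix
          e₂.symm e₂.symm).submatrix τ id) := by
      ext a b
      obtain ⟨c, rfl⟩ := e₂.surjective b
      have h3 : Fin.append X Y (e₂ c) = Sum.elim X Y c := by
        rcases c with c | c
        · exact Fin.append_left X Y c
        · exact Fin.append_right X Y c
      simp only [Matrix.of_apply, Matrix.submatrix_apply, id, Equiv.symm_apply_apply, h3, hτ,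
        Equiv.trans_apply]
      rcases c with c | c <;> rfl
    rw [h2, Matrix.det_permute, ← mul_assoc, hs2, one_mul]
  have hB (ε : ℝ) (hε : ε ≠ 0) :
      (Matrix.of fun a b => Sum.elim (fun j => g a (X j))
        (fun j => ε⁻¹ * (g a (X j + ε) - g a (X j))) b).det
        = s * (K * (((∏ l, w (X l)) * ∏ l, w (X l + ε)) * (D * D
          * ∏ i, ∏ k ∈ {i}ᶜ, (X k - X i + ε)))) := by
    have h1 := det_divided_difference
      (Matrix.of fun a b => Sum.elim (fun j => g a (X j)) (fun j => g a (X j + ε)) b) ε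
    simp only [Matrix.of_apply, Sum.elim_inl, Sum.elim_inr] at h1
    rw [h1, hA fun j => X j + ε, prod_prod_sub_add]
    simp only [add_sub_add_right_eq_sub, ← hD]
    rw [inv_pow]
    field_simp
  have hlim : Tendsto (fun ε : ℝ => (Matrix.of fun a b => Sum.elim (fun j => g a (X j))
        (fun j => ε⁻¹ * (g a (X j + ε) - g a (X j))) b).det) (𝓝[≠] 0)
      (𝓝 (Matrix.of fun a b => Sum.elim (fun j => g a (X j)) (fun j => g' a (X j)) b).det) := by
    refine ((continuous_id.matrix_det).tendsto _).comp ?_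
    refine tendsto_pi_nhds.2 fun a => tendsto_pi_nhds.2 fun b => ?_
    rcases b with j | j
    · exact tendsto_const_nhds
    · exact hasDerivAt_iff_tendsto_slope_zero.1 (hg' a (X j))
  have hlim2 : Tendsto (fun ε : ℝ => s * (K * (((∏ l, w (X l)) * ∏ l, w (X l + ε)) * (D * D
          * ∏ i, ∏ k ∈ {i}ᶜ, (X k - X i + ε))))) (𝓝[≠] 0)
      (𝓝 (s * (K * (((∏ l, w (X l)) * ∏ l, w (X l + 0)) * (D * D
          * ∏ i, ∏ k ∈ {i}ᶜ, (X k - X i + 0)))))) := by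
    refine Tendsto.mono_left (Continuous.tendsto ?_ 0) nhdsWithin_le_nhds
    fun_prop
  rw [tendsto_nhds_unique_of_eventuallyEq hlim hlim2
    (eventually_nhdsWithin_of_forall fun ε hε => hB ε hε)]
  simp only [add_zero]
  rw [prod_off_diag_eq]
  ring

/-! ### The GSE density. -/

/-- The partial integral of a confluent determinant. -/
def confluentKernel {n : ℕ} (g g' : Fin (n + 1) ⊕ Fin (n + 1) → ℝ → ℝ) (x : ℝ) : ℝ :=
  ∫ t : Fin n → ℝ, (Matrix.of fun a b =>
    Sum.elim (fun j => g a ((Fin.cons x t : Fin (n + 1) → ℝ) j))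
      (fun j => g' a ((Fin.cons x t : Fin (n + 1) → ℝ) j)) b).det

/-- In the Leibniz expansion each variable occurs in exactly two factors, one g and one g', so every
integrated variable yields one pairing and the free variable keeps its pair. -/
theorem confluentKernel_eq {n : ℕ} {g g' : Fin (n + 1) ⊕ Fin (n + 1) → ℝ → ℝ}
    (hi : ∀ a b, Integrable fun x => g a x * g' b x) (x : ℝ) :
    confluentKernel g g' x
      = ∑ a, g a x * ∑ b, pfaffCoeff (fun a b => ∫ x, g a x * g' b x) a b * g' b x := by
  have hint (σ : Perm (Fin (n + 1) ⊕ Fin (n + 1))) : Integrable fun t : Fin n → ℝ =>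
      ((Perm.sign σ : ℤ) : ℝ) * (g (σ (.inl 0)) x * g' (σ (.inr 0)) x)
        * ∏ j : Fin n, (g (σ (.inl j.succ)) (t j) * g' (σ (.inr j.succ)) (t j)) :=
    (Integrable.fintype_prod fun j : Fin n => hi (σ (.inl j.succ)) (σ (.inr j.succ))).const_mul _
  calc confluentKernel g g' x = ∫ t : Fin n → ℝ, ∑ σ : Perm (Fin (n + 1) ⊕ Fin (n + 1)),
        ((Perm.sign σ : ℤ) : ℝ) * (g (σ (.inl 0)) x * g' (σ (.inr 0)) x)
        * ∏ j : Fin n, (g (σ (.inl j.succ)) (t j) * g' (σ (.inr j.succ)) (t j)) := by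
        rw [confluentKernel]
        congr with t
        rw [Matrix.det_apply']
        refine Finset.sum_congr rfl fun σ _ => ?_
        rw [Fintype.prod_sum_type]
        simp only [Matrix.of_apply, Sum.elim_inl, Sum.elim_inr]
        rw [← Finset.prod_mul_distrib, Fin.prod_univ_succ]
        simp only [Fin.cons_zero, Fin.cons_succ]
        ring
    _ = ∑ σ : Perm (Fin (n + 1) ⊕ Fin (n + 1)),
        ((Perm.sign σ : ℤ) : ℝ) * (g (σ (.inl 0)) x * g' (σ (.inr 0)) x)
        * ∏ j : Fin n, ∫ y, g (σ (.inl j.succ)) y * g' (σ (.inr j.succ)) y := by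
        rw [integral_finsetSum _ fun σ _ => hint σ]
        refine Finset.sum_congr rfl fun σ _ => ?_
        rw [integral_const_mul, integral_fintype_prod_volume_eq_prod
          (fun (j : Fin n) y => g (σ (.inl j.succ)) y * g' (σ (.inr j.succ)) y)]
    _ = _ := by
        simp only [sum_pfaffCoeff_mul, Finset.mul_sum]
        rw [Finset.sum_comm]
        refine Finset.sum_congr rfl fun σ _ => ?_
        simp only [mul_ite, mul_zero, Finset.sum_ite_eq, Finset.mem_univ, if_true]
        ring

/-- Rescaling by √2 turns the weight exp(-2x²) into the square of the Hermite weight, as the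
confluent determinant requires. -/
theorem gaussianDensity_four_eq_confluentKernel {n : ℕ}
    {g g' : Fin (n + 1) ⊕ Fin (n + 1) → ℝ → ℝ} {K : ℝ} (hK : K ≠ 0)
    (h : ∀ X : Fin (n + 1) → ℝ,
      (Matrix.of fun a b => Sum.elim (fun j => g a (X j)) (fun j => g' a (X j)) b).det
        = K * ((∏ l, gaussianWeight 1 (X l)) ^ 2
          * (∏ i, ∏ j ∈ Finset.Ioi i, (X j - X i)) ^ 4)) :
    ∃ c : ℝ, ∀ x, gaussianDensity 4 (n + 1) x = c * confluentKernel g g' (√2 * x) := by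
  set S : ℝ := ∏ i : Fin (n + 1), ∏ _j ∈ Finset.Ioi i, √2 with hS
  have hS0 : S ≠ 0 :=
    Finset.prod_ne_zero_iff.2 fun i _ => Finset.prod_ne_zero_iff.2 fun j _ => by positivity
  have hpdf (X : Fin (n + 1) → ℝ) : eigenvaluePDF (gaussianWeight 4) 4 (n + 1) X
      = (K * S ^ 4)⁻¹ * (Matrix.of fun a b => Sum.elim (fun j => g a (√2 * X j))
        (fun j => g' a (√2 * X j)) b).det := by
    have h1 := h fun j => √2 * X j
    simp only [← mul_sub, Finset.prod_mul_distrib, ← hS] at h1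
    rw [h1, eigenvaluePDF]
    have h2 (y : ℝ) : gaussianWeight 1 (√2 * y) ^ 2 = gaussianWeight 4 y := by
      rw [gaussianWeight, gaussianWeight, ← Real.exp_nat_mul, mul_pow, Real.sq_sqrt (by norm_num)]
      congr 1; push_cast; ring
    have h3 (y : ℝ) : |y| ^ (4 : ℝ) = y ^ 4 := by
      rw [show (4 : ℝ) = ((4 : ℕ) : ℝ) by norm_num, Real.rpow_natCast,
        Even.pow_abs (by decide)]
    have h4 : (∏ l, gaussianWeight 1 (√2 * X l)) ^ 2 = ∏ l, gaussianWeight 4 (X l) := by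
      rw [← Finset.prod_pow]
      exact Finset.prod_congr rfl fun l _ => h2 (X l)
    rw [h4]
    simp only [h3, Finset.prod_pow]
    field_simp
  refine ⟨((n + 1 : ℕ) : ℝ) / partitionFunction (gaussianWeight 4) 4 (n + 1)
    * ((K * S ^ 4)⁻¹ * |((√2) ^ n)⁻¹|), fun x => ?_⟩
  rw [gaussianDensity, eigenvalueDensity, mul_assoc]
  congr 1
  have hs := Measure.integral_comp_smul (volume : Measure (Fin n → ℝ))
    (fun t : Fin n → ℝ => (Matrix.of fun a b =>
      Sum.elim (fun j => g a ((Fin.cons (√2 * x) t : Fin (n + 1) → ℝ) j))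
      (fun j => g' a ((Fin.cons (√2 * x) t : Fin (n + 1) → ℝ) j)) b).det) (√2)
  rw [Module.finrank_fin_fun, smul_eq_mul] at hs
  rw [mul_assoc, confluentKernel, ← hs, ← integral_const_mul]
  congr with t
  rw [hpdf]
  have hcons (j : Fin (n + 1)) : √2 * (Fin.cons x t : Fin (n + 1) → ℝ) j
      = (Fin.cons (√2 * x) (√2 • t) : Fin (n + 1) → ℝ) j := by
    refine Fin.cases ?_ (fun k => ?_) j <;> simp
  simp only [hcons]

/-- Supplies the even degrees 2k in the GSE family, the odd ones being given by ψ_{2k+1} itself. -/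
theorem signTransform_psi_odd_eq (k : ℕ) : ∃ q : ℝ[X], q.natDegree = 2 * k ∧ q ≠ 0 ∧
    ∀ x, signTransform (psi (2 * k + 1)) x = q.eval x * gaussianWeight 1 x := by
  induction k with
  | zero =>
    refine ⟨C 2, by simp, by simp, fun x => ?_⟩
    rw [show 2 * 0 + 1 = 1 from rfl, signTransform_psi_one]
    simp [psi, monicHermite]
  | succ k ih =>
    obtain ⟨q, hq, -, h⟩ := ih
    obtain ⟨hm, hd⟩ := monicHermite_monic_natDegree (2 * k + 2)
    have hc : (C 2 * monicHermite (2 * k + 2) + C (((2 * k + 1 : ℕ) + 1 : ℝ) / 2) * q).coeff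
        (2 * k + 2) = 2 := by
      have h1 : (monicHermite (2 * k + 2)).coeff (2 * k + 2) = 1 := by
        have := hm.coeff_natDegree; rwa [hd] at this
      rw [coeff_add, coeff_C_mul, coeff_C_mul, h1,
        coeff_eq_zero_of_natDegree_lt (p := q) (by omega)]
      ring
    refine ⟨C 2 * monicHermite (2 * k + 2) + C (((2 * k + 1 : ℕ) + 1 : ℝ) / 2) * q, ?_, ?_,
      fun x => ?_⟩
    · refine natDegree_eq_of_le_of_coeff_ne_zero ?_
        (by rw [show 2 * (k + 1) = 2 * k + 2 by ring, hc]; norm_num)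
      refine (natDegree_add_le _ _).trans (max_le ?_ ?_)
      · exact (natDegree_C_mul_le _ _).trans hd.le
      · exact (natDegree_C_mul_le _ _).trans (by omega)
    · intro h0
      rw [h0] at hc
      simp at hc
    · rw [show 2 * (k + 1) + 1 = 2 * k + 1 + 2 by ring, signTransform_psi_add_two, h]
      simp only [psi, eval_add, eval_mul, eval_C]
      ring

/-- The family consists of the antiderivatives of -2ψ_{2k+1} and ψ_{2k+1}', so its pairing ∫ g_a
g_b' reduces to the same skew pairings as for the GOE, and the same odd-index sum appears. -/
theorem gaussianDensity_four (n : ℕ) :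
    ∃ c : ℝ, ∀ x, gaussianDensity 4 (n + 1) x = c * skewSum (2 * (n + 1) + 1) (√2 * x) := by
  obtain ⟨e, he⟩ := exists_equiv_fin_two_mul (n + 1)
  choose q hqd hq0 hq using signTransform_psi_odd_eq
  let g : Fin (n + 1) ⊕ Fin (n + 1) → ℝ → ℝ :=
    Sum.elim (fun k => signTransform (psi (2 * k + 1))) (fun k => psi (2 * k + 1))
  let g' : Fin (n + 1) ⊕ Fin (n + 1) → ℝ → ℝ :=
    Sum.elim (fun k x => -2 * psi (2 * k + 1) x) (fun k => dpsi (2 * k + 1))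
  let p : Fin (n + 1) ⊕ Fin (n + 1) → ℝ[X] :=
    Sum.elim (fun k => q k) (fun k => monicHermite (2 * k + 1))
  have hgp (a) (x : ℝ) : g a x = (p a).eval x * gaussianWeight 1 x := by
    rcases a with k | k
    · exact hq _ _
    · exact psi_eq _ _
  have hp (a) : p a ≠ 0 := by
    rcases a with k | k
    · exact hq0 _
    · exact (monicHermite_monic_natDegree _).1.ne_zero
  have hdeg (a) : (p a).natDegree = e a := by
    rcases a with k | k
    · rw [(he k).1]; exact hqd _
    · rw [(he k).2]; exact (monicHermite_monic_natDegree _).2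
  have hgg' (a) (x : ℝ) : HasDerivAt (g a) (g' a x) x := by
    rcases a with k | k
    · exact hasDerivAt_signTransform (integrable_psi _) (continuous_psi _) x
    · exact hasDerivAt_psi _ x
  have hw : Continuous (gaussianWeight 1) := continuous_iff_continuousAt.2 fun x =>
    (hasDerivAt_gaussianWeight_one x).continuousAt
  obtain ⟨K, hK, hdet⟩ := exists_det_confluent hw hp hdeg hgp hgg'
  obtain ⟨c, hc⟩ := gaussianDensity_four_eq_confluentKernel hK hdet
  have hi (a b) : Integrable fun x => g a x * g' b x := by
    have hE {f : ℝ → ℝ} (hf : Integrable f) (k : ℕ) :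
        Integrable fun x => signTransform (psi k) x * f x :=
      (integrable_mul_signTransform hf (integrable_psi k) (continuous_psi k)).congr
        (ae_of_all _ fun _ => mul_comm _ _)
    rcases a with k | k <;> rcases b with l | l
    · exact hE ((integrable_psi _).const_mul (-2)) _
    · exact hE (integrable_dpsi _) _
    · exact ((integrable_psi_mul_psi (2 * k + 1) (2 * l + 1)).const_mul (-2)).congr
        (ae_of_all _ fun _ => mul_left_comm _ _ _)
    · exact integrable_psi_mul_dpsi _ _
  set M : Fin (n + 1) ⊕ Fin (n + 1) → Fin (n + 1) ⊕ Fin (n + 1) → ℝ :=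
    fun a b => ∫ x, g a x * g' b x with hM
  have h11 (k l : Fin (n + 1)) : M (.inl k) (.inl l) = 0 := by
    have := integral_psi_mul_signTransform_psi_of_even (m := 2 * l + 1) (n := 2 * k + 1)
      ⟨l + k + 1, by ring⟩
    simp only [M, g, g', Sum.elim_inl, mul_left_comm _ (-2 : ℝ), integral_const_mul]
    simp only [mul_comm (signTransform _ _), this, mul_zero]
  have h22 (k l : Fin (n + 1)) : M (.inr k) (.inr l) = 0 := by
    have := integral_dpsi_mul_signTransform_dpsi (m := 2 * l + 1) (n := 2 * k + 1)
      ⟨l + k + 1, by ring⟩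
    simp only [signTransform_dpsi, mul_left_comm _ (-2 : ℝ), integral_const_mul] at this
    simp only [M, g, g', Sum.elim_inr, mul_comm (psi _ _)]
    linarith
  have h12 (k l : Fin (n + 1)) :
      M (.inl k) (.inr l) = if k = l then 2 * psiNorm (2 * k + 1) else 0 := by
    simp only [M, g, g', Sum.elim_inl, Sum.elim_inr, mul_comm (signTransform _ _),
      integral_dpsi_mul_signTransform_psi]
    by_cases h : k = l
    · simp [h]
    · rw [if_neg, if_neg h]
      simpa [Fin.ext_iff, eq_comm] using h
  have h21 (k l : Fin (n + 1)) :
      M (.inr k) (.inl l) = if k = l then -2 * psiNorm (2 * k + 1) else 0 := by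
    simp only [M, g, g', Sum.elim_inl, Sum.elim_inr, mul_left_comm _ (-2 : ℝ), integral_const_mul,
      integral_psi_mul_psi]
    by_cases h : k = l
    · simp [h]
    · rw [if_neg, if_neg h, mul_zero]
      simpa [Fin.ext_iff] using h
  have hanti (a b) : M a b = - M b a := by
    rcases a with k | k <;> rcases b with l | l
    · simp [h11]
    · rw [h12, h21]; by_cases h : k = l <;> simp [h, eq_comm]
    · rw [h12, h21]; by_cases h : k = l <;> simp [h, eq_comm]
    · simp [h22]
  have hne (k : ℕ) := psiNorm_ne_zero k
  refine ⟨c * ((∑ σ, pfaffTerm M σ) / Fintype.card (Fin (n + 1) ⊕ Fin (n + 1))), fun x => ?_⟩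
  have hoff (b b' : Fin (n + 1) ⊕ Fin (n + 1)) (h : b' ≠ b) : M b.swap b' = 0 := by
    rcases b with k | k <;> rcases b' with l | l
    · rw [Sum.swap_inl, h21, if_neg (by simpa [eq_comm] using h)]
    · exact h22 _ _
    · exact h11 _ _
    · rw [Sum.swap_inr, h12, if_neg (by simpa [eq_comm] using h)]
  have hdiag (b : Fin (n + 1) ⊕ Fin (n + 1)) : M b.swap b ≠ 0 := by
    rcases b with k | k
    · simp [h21, hne]
    · simp [h12, hne]
  rw [hc, confluentKernel_eq hi, sum_mul_sum_eq_of_partner Sum.swap (sum_pfaffCoeff_mul_eq hanti)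
    hoff hdiag (fun a => g a (√2 * x)) (fun b => g' b (√2 * x)), ← mul_assoc]
  congr 1
  rw [Fintype.sum_sum_type, ← sum_skewTerm_odd,
    ← Fin.sum_univ_eq_sum_range (fun k => skewTerm (2 * k + 1) (√2 * x)),
    ← Finset.sum_add_distrib]
  refine Finset.sum_congr rfl fun k _ => ?_
  rw [Sum.swap_inl, Sum.swap_inr, h21, h12, if_pos rfl, if_pos rfl]
  simp only [g, g', Sum.elim_inl, Sum.elim_inr, skewTerm]
  have := hne (2 * k + 1)
  field_simp

/-! ### Assembling the two ensembles. -/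

theorem rpow_one_div_six_pow_six {x : ℝ} (hx : 0 < x) :
    0 < x ^ (1 / 6 : ℝ) ∧ x = (x ^ (1 / 6 : ℝ)) ^ 6 := by
  refine ⟨Real.rpow_pos_of_pos hx _, ?_⟩
  rw [← Real.rpow_natCast, ← Real.rpow_mul hx.le]
  norm_num

theorem hasDerivAt_neg_signTransform_psi_div_two (n : ℕ) (C x : ℝ) :
    HasDerivAt (fun x => -signTransform (psi n) x / 2 + C) (psi n x) x :=
  (((hasDerivAt_signTransform (integrable_psi n) (continuous_psi n) x).neg.div_const 2).add_const
    C).congr_deriv (by ring)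

theorem skewForm_add (n x a b E C : ℝ) : skewForm n x a b (E + C) = skewForm n x a b E + b * C := by
  rw [skewForm, skewForm]; ring

/-- Since `skewForm` is affine in E with slope ψ_m, the additional term of the odd-size density
becomes a constant of integration; both parities then have one form. -/
theorem gaussianDensity_one_eq_skewForm (m : ℕ) : ∃ c C : ℝ, ∀ x,
    gaussianDensity 1 (m + 1) x = c * skewForm (m + 1) x (psi (m + 1) x) (psi m x)
      (-signTransform (psi (m + 1)) x / 2 + C) := by
  have hne := psiNorm_ne_zero m
  rcases Nat.even_or_odd' m with ⟨k, rfl | rfl⟩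
  · obtain ⟨c, hc⟩ := gaussianDensity_one_odd k
    refine ⟨c / psiNorm (2 * k), psiNorm (2 * k) / ∫ t, psi (2 * k) t, fun x => ?_⟩
    rw [hc, skewForm_add, ← psiNorm_mul_skewSum]
    field_simp
  · obtain ⟨c, hc⟩ := gaussianDensity_one_even k
    refine ⟨c / psiNorm (2 * k + 1), 0, fun x => ?_⟩
    rw [add_zero, ← psiNorm_mul_skewSum, show 2 * k + 1 + 1 = 2 * (k + 1) by ring, hc]
    field_simp

end

theorem mainTheorem8 (N : ℕ) (hN : 1 ≤ N) (β : ℝ) (hβ : β = 1 ∨ β = 4) :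
    ContDiff ℝ 5 (softEdgeDensity β N) ∧
      ∀ y : ℝ,
        opD0 β (softEdgeDensity β N) y
          + 1 / shiftedN β N ^ (2 / 3 : ℝ) * opD1 β (softEdgeDensity β N) y
          + 1 / shiftedN β N ^ (4 / 3 : ℝ) * opD2 β (softEdgeDensity β N) y = 0 := by
  obtain ⟨n, rfl⟩ := Nat.exists_eq_add_of_le' hN
  have hn : (0 : ℝ) ≤ n := n.cast_nonneg
  rcases hβ with rfl | rfl
  · have hs : shiftedN 1 (n + 1) = n + 1 / 2 := by
      rw [shiftedN]; push_cast; ring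
    obtain ⟨hr, hr6⟩ := rpow_one_div_six_pow_six (x := shiftedN 1 (n + 1)) (by rw [hs]; positivity)
    obtain ⟨c, C, hc⟩ := gaussianDensity_one_eq_skewForm n
    refine edge_ode_softEdgeDensity (q := 1) (c := c) (s := √2) n (Or.inl ⟨rfl, rfl⟩) hr (by positivity)
      (by rw [Real.sq_sqrt (by norm_num)]; norm_num) (by rw [← hr6, hs]; ring) hr6
      (hasDerivAt_neg_signTransform_psi_div_two (n + 1) C) fun x => ?_
    rw [div_self (by positivity), one_mul, hc]
  · have hs : shiftedN 4 (n + 1) = n + 1 + 1 / 4 := by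
      rw [shiftedN]; push_cast; ring
    obtain ⟨hr, hr6⟩ := rpow_one_div_six_pow_six (x := shiftedN 4 (n + 1)) (by rw [hs]; positivity)
    obtain ⟨c, hc⟩ := gaussianDensity_four n
    have hne := psiNorm_ne_zero (2 * (n + 1))
    -- The Hermite index 2N + 1 equals 2 (N + 1/4) + 1/2, that is q N'_s + 1/2 with q = 2; hence s =
    -- √(2q) = 2.
    refine edge_ode_softEdgeDensity (q := 2) (s := 2) (c := c / psiNorm (2 * (n + 1)))
      (2 * (n + 1)) (Or.inr ⟨rfl, rfl⟩) hr (by norm_num) (by norm_num)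
      (by rw [← hr6, hs]; push_cast; ring) hr6
      (hasDerivAt_neg_signTransform_psi_div_two (2 * (n + 1) + 1) 0) fun x => ?_
    rw [Real.div_sqrt, add_zero, ← psiNorm_mul_skewSum, hc]
    field_simp
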